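/- Let $n,d\ge 1$. For a finite multigraph $G$ on the vertex set $[n]=\{1,\dots,n\}$ (parallel edges and loops allowed) let $|G\rangle=\prod_{\{i,j\}}CZ_{i,j}\,|+\rangle^{\otimes n}$ be its graph state, where the product runs over all edges of $G$ with $i\ne j$, counted with multiplicity (so two parallel edges cancel, and loops are discarded). For angles $\theta\in[0,2\pi)^n$ let $p_{G,\theta}(x)$, $x\in\{0,1\}^n$, be the outcome distribution obtained when qubit $j$ of $|G\rangle$ is measured in the $X$-$Y$-plane basis $\frac{1}{\sqrt2}\big(|0\rangle\pm e^{i\theta_j}|1\rangle\big)$ for every $j$, the outcome $x_j=0$ corresponding to the sign $+$. Let $$m_2(G,\theta)=2^n\sum_{x\in\{0,1\}^n}p_{G,\theta}(x)^2$$ be its normalized second moment. Consider the following two random multigraphs on $[n]$. (a) Pairing model $\mathcal G_p(d,n)$, for $dn$ even: choose a uniformly random perfect matching $M$ of the $nd$ points $[n]\times[d]$, and let $G$ have one edge $\{i,i'\}$ for every pair $\{(i,j),(i',j')\}$ of $M$. (b) Matching model $\mathcal G_m(d,n)$, for $n$ even: choose $d$ independent uniformly random perfect matchings of $[n]$, and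 let $G$ be their union, with multiplicities. Let $\theta$ be uniformly distributed on $[0,2\pi)^n$ and independent of $G$. Let $d=d(n)$ be integers with $d(n)>2$ for all large $n$ and $d(n)=o(n^{1/2})$. Then, as $n\to\infty$ through the integers for which the model is defined ($n\,d(n)$ even in case (a), $n$ even in case (b)), in each of the two models $$\mathbb E_{G,\theta}\big[m_2(G,\theta)\big]=o(1)+\begin{cases}2 & \text{if } d(n) \text{ is odd},\\ 3 & \text{if } d(n)\text{ is even}.\end{cases}$$ -/

import Mathlib

open Filter Topology Asymptotics MeasureTheory ProbabilityTheory
open scoped BigOperators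

noncomputable section

/-- The type of perfect matchings of the complete graph on `V`. -/
abbrev PerfectMatching (V : Type*) : Type _ :=
  {M : (⊤ : SimpleGraph V).Subgraph // M.IsPerfectMatching}

open Classical in
/-- There are only finitely many perfect matchings of a finite set. -/
instance PerfectMatching.instFintype {V : Type*} [Fintype V] : Fintype (PerfectMatching V) :=
  Fintype.ofFinite _

/-- The edges of a perfect matching, as a multiset (each edge occurs once). -/
def PerfectMatching.edges {V : Type*} [Fintype V] (M : PerfectMatching V) : Multiset (Sym2 V) :=
  (Set.toFinite M.1.edgeSet).toFinset.val

/-- A multigraph on the vertices `0, …, n - 1`, given by its multiset of edges.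
Parallel edges and loops are allowed. -/
abbrev Multigraph (n : ℕ) : Type := Multiset (Sym2 (Fin n))

/-- The multigraph of the pairing model: every pair `{(i, j), (i', j')}` of the
matching of the `n * d` points contributes one edge `{i, i'}`. -/
def pairingMultigraph {n d : ℕ} (M : PerfectMatching (Fin n × Fin d)) : Multigraph n :=
  M.edges.map (Sym2.map Prod.fst)

/-- The multigraph of the matching model: the union with multiplicities of `d` perfect
matchings of the `n` vertices. -/
def matchingMultigraph {n d : ℕ} (M : Fin d → PerfectMatching (Fin n)) : Multigraph n :=
  ∑ k, (M k).edges

/-- The state space of `n` qubits, with computational basis indexed by `Fin n → Bool`. -/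
abbrev QubitSpace (n : ℕ) : Type := EuclideanSpace ℂ (Fin n → Bool)

open Classical in
/-- The diagonal entry at the basis state `z` of the gate `CZ` on the pair `e` of qubits:
`-1` if both qubits are in the state `1`, and `1` otherwise. Loops give no gate. -/
def czPhase {n : ℕ} (e : Sym2 (Fin n)) (z : Fin n → Bool) : ℂ :=
  if ¬ e.IsDiag ∧ ∀ i ∈ e, z i = true then -1 else 1

/-- The graph state of a multigraph: one `CZ` gate for each edge, counted with multiplicity
(so a pair of parallel edges cancels), applied to the state `|+⟩` on every qubit. -/
def graphState {n : ℕ} (G : Multigraph n) : QubitSpace n :=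
  WithLp.toLp 2 fun z => (G.map fun e => czPhase e z).prod * ((Real.sqrt (2 ^ n) : ℝ) : ℂ)⁻¹

/-- The vector `(|0⟩ + (-1)^b e^{i t} |1⟩) / √2` of the measurement basis at angle `t` in the
`X`-`Y` plane of one qubit, as a function of the computational basis label. -/
def xyQubit (t : ℝ) (b : Bool) (z : Bool) : ℂ :=
  (if z then (if b then -1 else 1) * Complex.exp (Complex.I * t) else 1)
    / ((Real.sqrt 2 : ℝ) : ℂ)

/-- The vector with label `x` of the `X`-`Y` plane product basis with angles `θ`. -/
def xyBasisVector {n : ℕ} (θ : Fin n → ℝ) (x : Fin n → Bool) : QubitSpace n :=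
  WithLp.toLp 2 fun z => ∏ j, xyQubit (θ j) (x j) (z j)

/-- The probability of the outcome `x` when the graph state of `G` is measured in the
`X`-`Y` plane product basis with angles `θ` (Born rule). -/
def outcomeProb {n : ℕ} (G : Multigraph n) (θ : Fin n → ℝ) (x : Fin n → Bool) : ℝ :=
  ‖inner ℂ (xyBasisVector θ x) (graphState G)‖ ^ 2

/-- The normalized second moment `2 ^ n * ∑ x, p (x) ^ 2` of the outcome distribution. -/
def secondMoment {n : ℕ} (G : Multigraph n) (θ : Fin n → ℝ) : ℝ :=
  2 ^ n * ∑ x : Fin n → Bool, outcomeProb G θ x ^ 2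

/-- The law of `n` independent angles, each uniform on `[0, 2π)`. -/
def angleMeasure (n : ℕ) : Measure (Fin n → ℝ) :=
  Measure.pi fun _ => cond volume (Set.Ico 0 (2 * Real.pi))

/-- The expectation of the normalized second moment over a uniformly random perfect matching
of the `n * d` points of the pairing model and over uniformly random angles. -/
def pairingSecondMoment (n d : ℕ) : ℝ :=
  𝔼 M : PerfectMatching (Fin n × Fin d),
    ∫ θ, secondMoment (pairingMultigraph M) θ ∂angleMeasure n

/-- The expectation of the normalized second moment over `d` independent uniformly random
perfect matchings of the `n` vertices (that is, over a uniformly random `d`-tuple of them)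
and over uniformly random angles. -/
def matchingSecondMoment (n d : ℕ) : ℝ :=
  𝔼 M : Fin d → PerfectMatching (Fin n),
    ∫ θ, secondMoment (matchingMultigraph M) θ ∂angleMeasure n

end

/-! Expanding the second moment puts four basis labels, two bras and two kets, on each qubit.
Averaging over the angle keeps the six quadruples whose bra sum equals the ket sum, two for each of
three colours. The gates on an edge then give -1 exactly when its ends have colours 1 and 2
(`quadSign_singleton`), so the average is 2^(-n) times a sum over 3-colourings of a product of edge
signs (`integral_secondMoment`). Averaging over the graph replaces this product by a mean over
matchings: `cutMean c ^ d` in the matching model, one mean over `n * d` points in the pairing model.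

Main term (`abs_sum_sub_le`): a colouring that misses 1 or misses 2 has mean 1, which gives 2^n
twice. Those that miss 0 have sign (-1)^(d * number of 1s), which sums to 2^n for even d and to 0
for odd d. The monochromatic overlaps cost 3 * 2^(-n).

Remainder: the colourings that use all three colours. Up to sign their mean is `colorMean`, a
symmetric function of the colour counts with a recursion from exposing the partner of one point. If
a colour occurs a times with a small against n, `abs_triMean_le_of_rare` gives a bound of shape
(|D|/n + √(a/n))^a, with D the imbalance of the other two. Its cube, available because d > 2, beats
the number of such colourings and leaves O(n^(-1/2)).

If no colour is rare, the mean is exponentially small (`abs_triMean_le_pow`), but there may be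
nearly 3^n colourings against the normalisation 2^n. The L² bound `sum_colorMean_sq` absorbs them
using two powers of the mean, and the remaining power gives decay. In the pairing model the L² bound
on `n * d` points is brought down to n vertices by using d colourings with equal counts at once. -/

noncomputable section

/-! ### Perfect matchings and weighted sums over them -/

open Classical in
/-- The perfect matchings of a finite set `s`, as sets of edges. -/
def matchingsOn {V : Type*} (s : Finset V) : Finset (Finset (Sym2 V)) :=
  s.sym2.powerset.filter fun M => (∀ e ∈ M, ¬ e.IsDiag) ∧ ∀ v ∈ s, ∃! e, e ∈ M ∧ v ∈ e

/-- The sum over the perfect matchings of `s` of the product of the weights of the edges. -/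
def matchSum {V : Type*} (K : Sym2 V → ℝ) (s : Finset V) : ℝ :=
  ∑ M ∈ matchingsOn s, ∏ e ∈ M, K e

theorem mem_matchingsOn {V : Type*} {s : Finset V} {M : Finset (Sym2 V)} :
    M ∈ matchingsOn s ↔ (∀ e ∈ M, ∀ v ∈ e, v ∈ s) ∧ (∀ e ∈ M, ¬ e.IsDiag) ∧
      ∀ v ∈ s, ∃! e, e ∈ M ∧ v ∈ e := by
  simp only [matchingsOn, Finset.mem_filter, Finset.mem_powerset, Finset.subset_iff,
    Finset.mem_sym2_iff]

theorem matchSum_empty {V : Type*} (K : Sym2 V → ℝ) : matchSum K (∅ : Finset V) = 1 := by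
  have : matchingsOn (∅ : Finset V) = {∅} := by
    ext M
    simp [matchingsOn]
    rintro rfl
    simp
  simp [matchSum, this]

open Classical in
theorem insert_mem_matchingsOn {V : Type*} {s : Finset V} {v w : V}
    (hw : w ∈ s.erase v) (hv : v ∈ s) {M : Finset (Sym2 V)}
    (hM : M ∈ matchingsOn ((s.erase v).erase w)) : insert s(v, w) M ∈ matchingsOn s := by
  rw [mem_matchingsOn] at hM ⊢
  obtain ⟨h1, h2, h3⟩ := hM
  have hwv : w ≠ v := (Finset.mem_erase.1 hw).1
  have hws : w ∈ s := (Finset.mem_erase.1 hw).2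
  refine ⟨?_, ?_, ?_⟩
  · intro e he x hx
    rcases Finset.mem_insert.1 he with rfl | he
    · rcases Sym2.mem_iff.1 hx with rfl | rfl <;> assumption
    · exact Finset.mem_of_mem_erase (Finset.mem_of_mem_erase (h1 e he x hx))
  · intro e he
    rcases Finset.mem_insert.1 he with rfl | he
    · simpa using hwv.symm
    · exact h2 e he
  · intro x hx
    by_cases hxx : x = v ∨ x = w
    · refine ⟨s(v, w), ⟨Finset.mem_insert_self _ _, by simpa using hxx⟩, ?_⟩
      rintro e ⟨he, hxe⟩
      rcases Finset.mem_insert.1 he with rfl | he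
      · rfl
      · have := h1 e he x hxe
        simp only [Finset.mem_erase] at this
        tauto
    · push Not at hxx
      obtain ⟨e, ⟨he, hxe⟩, huniq⟩ := h3 x (by simp [hxx, hx])
      refine ⟨e, ⟨Finset.mem_insert_of_mem he, hxe⟩, ?_⟩
      rintro e' ⟨he', hxe'⟩
      rcases Finset.mem_insert.1 he' with rfl | he'
      · simp [hxx] at hxe'
      · exact huniq e' ⟨he', hxe'⟩

theorem notMem_of_matchingsOn_erase {V : Type*} [DecidableEq V] {s : Finset V} {v w : V}
    {M : Finset (Sym2 V)} (hM : M ∈ matchingsOn ((s.erase v).erase w)) (x : V) : s(v, x) ∉ M := by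
  intro h
  have := (mem_matchingsOn.1 hM).1 _ h v (by simp)
  simp at this

-- Exposing the partner `w` of `v`: a matching of `s` is, in a unique way, the edge `s(v, w)`
-- together with a matching of the rest. All later recursions come from this one.
open Classical in
theorem matchSum_eq_sum_erase {V : Type*} (K : Sym2 V → ℝ) {s : Finset V} {v : V}
    (hv : v ∈ s) :
    matchSum K s = ∑ w ∈ s.erase v, K s(v, w) * matchSum K ((s.erase v).erase w) := by
  simp only [matchSum, Finset.mul_sum]
  rw [Finset.sum_sigma']
  symm
  refine Finset.sum_bij (fun x _ => insert s(v, x.1) x.2) ?_ ?_ ?_ ?_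
  · rintro ⟨w, M⟩ h
    obtain ⟨hw, hM⟩ := Finset.mem_sigma.1 h
    exact insert_mem_matchingsOn hw hv hM
  · rintro ⟨w, M⟩ h ⟨w', M'⟩ h' heq
    obtain ⟨hw, hM⟩ := Finset.mem_sigma.1 h
    obtain ⟨hw', hM'⟩ := Finset.mem_sigma.1 h'
    simp only at hw hM hw' hM' heq
    have hmem : s(v, w) ∈ insert s(v, w') M' := heq ▸ Finset.mem_insert_self _ _
    have : w = w' := by
      rcases Finset.mem_insert.1 hmem with h | h
      · exact Sym2.congr_right.1 h
      · exact absurd h (notMem_of_matchingsOn_erase hM' _)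
    subst this
    congr 1
    have := congrArg (fun t => t.erase s(v, w)) heq
    simpa [Finset.erase_insert (notMem_of_matchingsOn_erase hM _),
      Finset.erase_insert (notMem_of_matchingsOn_erase hM' _)] using this
  · intro M hM
    obtain ⟨h1, h2, h3⟩ := mem_matchingsOn.1 hM
    obtain ⟨e, ⟨he, hve⟩, huniq⟩ := h3 v hv
    obtain ⟨w, rfl⟩ := Sym2.mem_iff_exists.1 hve
    have hwv : w ≠ v := by
      have := h2 _ he
      simpa [eq_comm] using this
    have hws : w ∈ s := h1 _ he w (by simp)
    have hmem : M.erase s(v, w) ∈ matchingsOn ((s.erase v).erase w) := by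
      rw [mem_matchingsOn]
      refine ⟨?_, fun e he => h2 e (Finset.mem_of_mem_erase he), ?_⟩
      · intro e he' x hx
        obtain ⟨hne, heM⟩ := Finset.mem_erase.1 he'
        refine Finset.mem_erase.2 ⟨?_, Finset.mem_erase.2 ⟨?_, h1 e heM x hx⟩⟩
        · rintro rfl
          obtain ⟨e0, -, hu⟩ := h3 x hws
          exact hne ((hu e ⟨heM, hx⟩).trans (hu s(v, x) ⟨he, by simp⟩).symm)
        · rintro rfl
          exact hne (huniq e ⟨heM, hx⟩)
      · intro x hx
        simp only [Finset.mem_erase] at hx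
        obtain ⟨e, ⟨heM, hxe⟩, hu⟩ := h3 x hx.2.2
        refine ⟨e, ⟨Finset.mem_erase.2 ⟨?_, heM⟩, hxe⟩, fun e' he' =>
          hu e' ⟨Finset.mem_of_mem_erase he'.1, he'.2⟩⟩
        rintro rfl
        simp [hx.1, hx.2.1] at hxe
    exact ⟨⟨w, M.erase s(v, w)⟩, Finset.mem_sigma.2 ⟨Finset.mem_erase.2 ⟨hwv, hws⟩, hmem⟩,
      Finset.insert_erase he⟩
  · rintro ⟨w, M⟩ h
    obtain ⟨hw, hM⟩ := Finset.mem_sigma.1 h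
    rw [Finset.prod_insert (notMem_of_matchingsOn_erase hM _)]

/-- The number of perfect matchings of a set of `N` elements. -/
def matchCount : ℕ → ℝ
  | 0 => 1
  | 1 => 0
  | N + 2 => (N + 1) * matchCount N

theorem matchCount_nonneg (N : ℕ) : 0 ≤ matchCount N := by
  induction N using Nat.strong_induction_on with
  | _ N ih =>
    match N with
    | 0 => simp [matchCount]
    | 1 => simp [matchCount]
    | N + 2 => rw [matchCount]; exact mul_nonneg (by positivity) (ih N (by omega))

theorem matchCount_pos {N : ℕ} (h : Even N) : 0 < matchCount N := by
  obtain ⟨k, rfl⟩ := h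
  induction k with
  | zero => simp [matchCount]
  | succ k ih =>
    rw [show k + 1 + (k + 1) = (k + k) + 2 by ring, matchCount]
    positivity

open Classical in
/-- Induction over a finite set that removes two elements at a time. -/
theorem Finset.erase_pair_induction {V : Type*} {P : Finset V → Prop} (h0 : P ∅)
    (h1 : ∀ s : Finset V, ∀ v ∈ s, (∀ w ∈ s.erase v, P ((s.erase v).erase w)) → P s)
    (s : Finset V) : P s := by
  induction s using Finset.strongInduction with
  | _ s ih =>
    rcases s.eq_empty_or_nonempty with rfl | ⟨v, hv⟩
    · exact h0
    · exact h1 s v hv fun w _ => ih _ <|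
        ((s.erase v).erase_subset w).trans_ssubset (Finset.erase_ssubset hv)

theorem matchSum_one {V : Type*} (s : Finset V) : matchSum (fun _ => 1) s = matchCount s.card := by
  classical
  induction s using Finset.erase_pair_induction with
  | h0 => simp [matchSum_empty, matchCount]
  | h1 s v hv ih =>
    rw [matchSum_eq_sum_erase _ hv]
    have hc := Finset.card_erase_add_one hv
    rw [Finset.sum_congr rfl (g := fun _ => matchCount (s.card - 2))]
    · rw [Finset.sum_const, nsmul_eq_mul, ← hc]
      rcases (s.erase v).card with _ | k
      · simp [matchCount]
      · simp [matchCount]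
    · intro w hw
      rw [ih w hw, one_mul, Finset.card_erase_of_mem hw, Finset.card_erase_of_mem hv]
      rfl

/-- Vertex weights factor out of a sum over perfect matchings. -/
theorem matchSum_mul_prod {V : Type*} {K K' : Sym2 V → ℝ} {g : V → ℝ}
    (h : ∀ v w, v ≠ w → K' s(v, w) = g v * g w * K s(v, w)) (s : Finset V) :
    matchSum K' s = (∏ v ∈ s, g v) * matchSum K s := by
  classical
  induction s using Finset.erase_pair_induction with
  | h0 => simp [matchSum_empty]
  | h1 s v hv ih =>
    rw [matchSum_eq_sum_erase _ hv, matchSum_eq_sum_erase _ hv, Finset.mul_sum]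
    refine Finset.sum_congr rfl fun w hw => ?_
    rw [ih w hw, h v w (Finset.mem_erase.1 hw).1.symm, ← Finset.mul_prod_erase s g hv,
      ← Finset.mul_prod_erase _ g hw]
    ring

open Classical in
/-- The edges of a perfect matching are a perfect matching of the set of all vertices. -/
theorem sum_perfectMatching {V : Type*} [Fintype V] (K : Sym2 V → ℝ) :
    ∑ M : PerfectMatching V, (M.edges.map K).prod = matchSum K Finset.univ := by
  unfold matchSum PerfectMatching.edges
  refine Finset.sum_bij (fun M _ => (Set.toFinite M.1.edgeSet).toFinset) ?_ ?_ ?_ ?_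
  · intro M _
    rw [mem_matchingsOn]
    refine ⟨fun _ _ _ _ => Finset.mem_univ _, ?_, ?_⟩
    · intro e he
      rw [Set.Finite.mem_toFinset] at he
      exact (⊤ : SimpleGraph V).not_isDiag_of_mem_edgeSet (M.1.edgeSet_subset he)
    · intro v _
      obtain ⟨w, hw, hu⟩ := M.2.1 (M.2.2 v)
      refine ⟨s(v, w), ⟨by simpa using hw, by simp⟩, ?_⟩
      rintro e ⟨he, hve⟩
      obtain ⟨x, rfl⟩ := Sym2.mem_iff_exists.1 hve
      have : M.1.Adj v x := by simpa using he
      rw [hu x this]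
  · intro M _ M' _ h
    have hE : M.1.edgeSet = M'.1.edgeSet := by simpa using h
    refine Subtype.ext (SimpleGraph.Subgraph.ext ?_ ?_)
    · rw [M.2.2.verts_eq_univ, M'.2.2.verts_eq_univ]
    · funext v w
      rw [← SimpleGraph.Subgraph.mem_edgeSet, hE, SimpleGraph.Subgraph.mem_edgeSet]
  · intro M hM
    obtain ⟨-, h2, h3⟩ := mem_matchingsOn.1 hM
    refine ⟨⟨⟨Set.univ, fun v w => s(v, w) ∈ M, ?_, fun _ => Set.mem_univ _, ?_⟩, ?_, ?_⟩,
      Finset.mem_univ _, ?_⟩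
    · intro v w h
      have := h2 _ h
      simpa using this
    · exact ⟨fun v w h => by rwa [Sym2.eq_swap]⟩
    · intro v _
      obtain ⟨e, ⟨he, hve⟩, hu⟩ := h3 v (Finset.mem_univ _)
      obtain ⟨w, rfl⟩ := Sym2.mem_iff_exists.1 hve
      refine ⟨w, he, fun x hx => ?_⟩
      exact Sym2.congr_right.1 (hu s(v, x) ⟨hx, by simp⟩)
    · intro v
      exact Set.mem_univ _
    · ext e
      induction e with
      | _ v w => simp
  · intro M _
    rfl

theorem expect_perfectMatching {V : Type*} [Fintype V] (K : Sym2 V → ℝ) :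
    (𝔼 M : PerfectMatching V, (M.edges.map K).prod)
      = matchSum K Finset.univ / matchCount (Fintype.card V) := by
  have h1 := sum_perfectMatching (V := V) (fun _ => 1)
  simp only [Multiset.map_const', Multiset.prod_replicate, one_pow, Finset.sum_const,
    nsmul_eq_mul, mul_one, matchSum_one] at h1
  rw [Finset.expect_eq_sum_div_card, sum_perfectMatching, h1, Finset.card_univ]

/-! ### The mean sign of a matching as a function of colour counts -/

open Classical in
/-- The sign of an edge under a colouring: `-1` if its ends have different colours. -/
def colorSign {V : Type*} (c : V → Fin 3) (e : Sym2 V) : ℝ :=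
  if (e.map c).IsDiag then 1 else -1

open Classical in
/-- The sign of an edge under a colouring: `-1` if its ends have the colours `1` and `2`. -/
def cutSign {V : Type*} (c : V → Fin 3) (e : Sym2 V) : ℝ :=
  if e.map c = s(1, 2) then -1 else 1

/-- The sign of a pair of colours. -/
def pairSign (i j : Fin 3) : ℝ := if i = j then 1 else -1

theorem colorSign_mk {V : Type*} (c : V → Fin 3) (v w : V) :
    colorSign c s(v, w) = pairSign (c v) (c w) := by
  simp [colorSign, pairSign]

/-- The number of elements of each colour. -/
def colorCount {V : Type*} (c : V → Fin 3) (s : Finset V) (i : Fin 3) : ℕ :=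
  (s.filter (c · = i)).card

theorem sum_colorCount {V : Type*} (c : V → Fin 3) (s : Finset V) :
    ∑ i, colorCount c s i = s.card :=
  (Finset.card_eq_sum_card_fiberwise (f := c) (t := Finset.univ) (by simp [Set.MapsTo])).symm

theorem sum_color_eq {V : Type*} (c : V → Fin 3) (s : Finset V) (h : Fin 3 → ℝ) :
    ∑ v ∈ s, h (c v) = ∑ i, colorCount c s i * h i := by
  rw [← Finset.sum_fiberwise s c]
  refine Finset.sum_congr rfl fun i _ => ?_
  rw [Finset.sum_congr rfl (g := fun _ => h i)
    (fun v hv => by rw [(Finset.mem_filter.1 hv).2]), Finset.sum_const, nsmul_eq_mul]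
  rfl

open Classical in
theorem colorCount_erase {V : Type*} (c : V → Fin 3) {s : Finset V} {v : V} (hv : v ∈ s) :
    colorCount c (s.erase v) = colorCount c s - Pi.single (c v) 1 := by
  funext i
  simp only [colorCount, Pi.sub_apply, Finset.filter_erase]
  by_cases h : c v = i
  · subst h
    rw [Finset.card_erase_of_mem (by simp [hv]), Pi.single_eq_same]
  · rw [Finset.erase_eq_of_notMem (by simp [h]), Pi.single_eq_of_ne' h, Nat.sub_zero]

/-- A colour that occurs, if there is one. -/
def leadColor (k : Fin 3 → ℕ) : Fin 3 := if 0 < k 0 then 0 else if 0 < k 1 then 1 else 2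

/-- The signed number of perfect matchings of `N` points with `k i` points of colour `i`. -/
def colorSum : ℕ → (Fin 3 → ℕ) → ℝ
  | 0, _ => 1
  | 1, _ => 0
  | N + 2, k => ∑ j, (((k - Pi.single (leadColor k) 1 : Fin 3 → ℕ) j : ℕ) : ℝ) *
      (pairSign (leadColor k) j * colorSum N (k - Pi.single (leadColor k) 1 - Pi.single j 1))

/-- Exposing a point of the leading colour shows by induction that only the colour counts matter.
The choice of leading colour merely makes `colorSum` a definite recursion; `colorMean_add_single`
recovers the recursion for every colour. -/
theorem matchSum_colorSign {V : Type*} (c : V → Fin 3) (s : Finset V) :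
    matchSum (colorSign c) s = colorSum s.card (colorCount c s) := by
  classical
  induction h : s.card using Nat.strong_induction_on generalizing s with
  | _ N ih =>
    rcases s.eq_empty_or_nonempty with rfl | hs
    · simp at h
      simp [← h, matchSum_empty, colorSum]
    · have hlead : 0 < colorCount c s (leadColor (colorCount c s)) := by
        have h1 := sum_colorCount c s
        rw [Fin.sum_univ_three] at h1
        have := hs.card_pos
        unfold leadColor
        split_ifs <;> omega
      obtain ⟨v, hv⟩ := Finset.card_pos.1 hlead
      obtain ⟨hv, hcv⟩ := Finset.mem_filter.1 hv
      rw [matchSum_eq_sum_erase _ hv]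
      have hc := Finset.card_erase_add_one hv
      match N, h with
      | 0, h => omega
      | 1, h =>
        have : s.erase v = ∅ := Finset.card_eq_zero.1 (by omega)
        simp [this, colorSum]
      | N + 2, h =>
        rw [colorSum, ← hcv, ← colorCount_erase c hv]
        refine Eq.trans ?_ (sum_color_eq c (s.erase v) fun j =>
          pairSign (c v) j * colorSum N (colorCount c (s.erase v) - Pi.single j 1))
        refine Finset.sum_congr rfl fun w hw => ?_
        have hc' := Finset.card_erase_add_one hw
        rw [ih N (by omega) _ (by omega), colorSign_mk, colorCount_erase c hw]

/-- The mean sign of a uniformly random perfect matching of points with `k i` points of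
colour `i`, where the sign is the parity of the number of bichromatic edges. -/
def colorMean (k : Fin 3 → ℕ) : ℝ := colorSum (∑ i, k i) k / matchCount (∑ i, k i)

theorem matchSum_colorSign_div {V : Type*} (c : V → Fin 3) (s : Finset V) :
    matchSum (colorSign c) s / matchCount s.card = colorMean (colorCount c s) := by
  rw [colorMean, sum_colorCount, matchSum_colorSign]

theorem colorCount_sigma (k : Fin 3 → ℕ) :
    colorCount (Sigma.fst : (Σ i : Fin 3, Fin (k i)) → Fin 3) Finset.univ = k := by
  funext i
  rw [colorCount, Finset.card_filter, Fintype.sum_sigma]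
  simp [apply_ite Finset.card]

theorem colorMean_zero : colorMean 0 = 1 := by
  simp [colorMean, colorSum, matchCount]

theorem abs_matchSum_colorSign_le {V : Type*} (c : V → Fin 3) (s : Finset V) :
    |matchSum (colorSign c) s| ≤ matchCount s.card := by
  rw [← matchSum_one]
  refine (Finset.abs_sum_le_sum_abs _ _).trans (Finset.sum_le_sum fun M _ => ?_)
  rw [Finset.abs_prod]
  refine (Finset.prod_congr rfl fun e _ => ?_).le
  unfold colorSign
  split_ifs <;> simp

theorem abs_colorMean_le_one (k : Fin 3 → ℕ) : |colorMean k| ≤ 1 := by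
  rw [← colorCount_sigma k, ← matchSum_colorSign_div, abs_div, abs_of_nonneg (matchCount_nonneg _)]
  exact div_le_one_of_le₀ (abs_matchSum_colorSign_le _ _) (matchCount_nonneg _)

/-- The recursion obtained by exposing the partner of a point of colour `i`. -/
theorem colorMean_add_single (k : Fin 3 → ℕ) (i : Fin 3) :
    ((∑ j, k j : ℕ) : ℝ) * colorMean (k + Pi.single i 1)
      = ∑ j, k j * (pairSign i j * colorMean (k - Pi.single j 1)) := by
  classical
  -- Any coloured set with these counts will do; the disjoint union of the colour classes is one,
  -- and it has a point of colour `i` to expose.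
  obtain ⟨V, c, s, v, hv, hcv, hk⟩ : ∃ (V : Type) (c : V → Fin 3) (s : Finset V) (v : V),
      v ∈ s ∧ c v = i ∧ colorCount c s = k + Pi.single i 1 :=
    ⟨Σ j : Fin 3, Fin ((k + Pi.single i 1 : Fin 3 → ℕ) j), Sigma.fst, Finset.univ,
      ⟨i, ⟨0, by simp⟩⟩, Finset.mem_univ _, rfl, colorCount_sigma _⟩
  have hk' : colorCount c (s.erase v) = k := by
    rw [colorCount_erase c hv, hk, hcv]
    simp
  have hc := Finset.card_erase_add_one hv
  have hcard : ∑ j, k j = (s.erase v).card := by rw [← sum_colorCount c, hk']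
  rw [← hk, ← matchSum_colorSign_div, matchSum_eq_sum_erase _ hv, hcard]
  rw [← hk']
  refine Eq.trans ?_ (sum_color_eq c (s.erase v) fun j =>
    pairSign i j * colorMean (colorCount c (s.erase v) - Pi.single j 1))
  rw [Finset.sum_div, Finset.mul_sum]
  refine Finset.sum_congr rfl fun w hw => ?_
  have hc' := Finset.card_erase_add_one hw
  rw [← colorCount_erase c hw, ← matchSum_colorSign_div, colorSign_mk, hcv, ← hc, ← hc', matchCount]
  push_cast
  have : (((s.erase v).erase w).card + 1 : ℝ) ≠ 0 := by positivity
  field_simp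

theorem colorMean_comp_perm (k : Fin 3 → ℕ) (σ : Equiv.Perm (Fin 3)) :
    colorMean (k ∘ σ) = colorMean k := by
  conv_rhs => rw [← colorCount_sigma k, ← matchSum_colorSign_div]
  have h : k ∘ σ = colorCount (σ.symm ∘ (Sigma.fst : (Σ i : Fin 3, Fin (k i)) → Fin 3))
      Finset.univ := by
    funext i
    have := congrFun (colorCount_sigma k) (σ i)
    simp only [colorCount] at this ⊢
    simp only [Function.comp, Equiv.symm_apply_eq, this]
  rw [h, ← matchSum_colorSign_div]
  congr 2
  funext e
  induction e with
  | _ v w => simp [colorSign_mk, pairSign]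

/-! ### Pointwise decay of the mean sign -/

/-- `colorMean` as a function of three arguments. -/
def triMean (p q r : ℕ) : ℝ := colorMean ![p, q, r]

theorem colorMean_eq_triMean (k : Fin 3 → ℕ) : colorMean k = triMean (k 0) (k 1) (k 2) := by
  rw [triMean]
  congr 1
  funext i
  fin_cases i <;> rfl

theorem triMean_swap_left (p q r : ℕ) : triMean p q r = triMean q p r := by
  rw [triMean, ← colorMean_comp_perm _ (Equiv.swap 0 1), colorMean_eq_triMean]
  rfl

theorem triMean_swap_right (p q r : ℕ) : triMean p q r = triMean p r q := by
  rw [triMean, ← colorMean_comp_perm _ (Equiv.swap 1 2), colorMean_eq_triMean]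
  rfl

theorem triMean_rec (p q r : ℕ) :
    (p + q + r : ℝ) * triMean (p + 1) q r
      = p * triMean (p - 1) q r - q * triMean p (q - 1) r - r * triMean p q (r - 1) := by
  have h := colorMean_add_single ![p, q, r] 0
  simp only [Fin.sum_univ_three, colorMean_eq_triMean] at h
  simp [pairSign] at h
  rw [h]
  ring

theorem abs_triMean_le_one (p q r : ℕ) : |triMean p q r| ≤ 1 := abs_colorMean_le_one _

theorem triMean_rec_mid (p q r : ℕ) :
    (p + q + r : ℝ) * triMean p (q + 1) r
      = q * triMean p (q - 1) r - p * triMean (p - 1) q r - r * triMean p q (r - 1) := by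
  have h := triMean_rec q p r
  rw [triMean_swap_left p (q + 1), triMean_swap_left p (q - 1), triMean_swap_left (p - 1),
    triMean_swap_left p q]
  linarith

theorem triMean_rec_right (p q r : ℕ) :
    (p + q + r : ℝ) * triMean p q (r + 1)
      = r * triMean p q (r - 1) - p * triMean (p - 1) q r - q * triMean p (q - 1) r := by
  have h := triMean_rec_mid p r q
  rw [triMean_swap_right p q (r + 1), triMean_swap_right p q (r - 1), triMean_swap_right (p - 1),
    triMean_swap_right p (q - 1)]
  linarith

theorem abs_mul_of_pos_left {a b : ℝ} (ha : 0 < a) : |a * b| = a * |b| := by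
  rw [abs_mul, abs_of_pos ha]

/-- With an odd number of points `matchCount` is 0, and division by zero makes the mean 0. -/
theorem triMean_one : triMean 1 0 0 = 0 := by
  simp [triMean, colorMean, Fin.sum_univ_three, matchCount]

/-- Two successive exposures, the colour of the second chosen in each branch so that `(p + 2) * (r +
3)` reaches `triMean (p + 1) (q + 2) (r + 2)` once with each sign. After this cancellation the
absolute coefficients add up to the left-hand factor minus `2 * (p + 2) * (r + 3)`. -/
theorem triMean_add_three (p q r : ℕ) :
    (p + q + r + 8 : ℝ) * (p + q + r + 6) * triMean (p + 3) (q + 3) (r + 3)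
      = (p + 2) * ((q + 2) * triMean (p + 1) (q + 1) (r + 3) - (p + 1) * triMean p (q + 2) (r + 3))
        + (q + 3) * ((q + 2) * triMean (p + 2) (q + 1) (r + 2)
          - (r + 2) * triMean (p + 2) (q + 2) (r + 1))
        + (r + 3) * ((r + 2) * triMean (p + 2) (q + 2) (r + 1)
          - (q + 2) * triMean (p + 2) (q + 1) (r + 2))
        + (p + 2) * (q + 3) * triMean (p + 1) (q + 2) (r + 2) := by
  have h1 := triMean_rec (p + 2) (q + 3) (r + 3)
  have h2 := triMean_rec_mid (p + 1) (q + 2) (r + 3)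
  have h3 := triMean_rec_right (p + 2) (q + 2) (r + 2)
  have h4 := triMean_rec_mid (p + 2) (q + 2) (r + 2)
  simp only [Nat.add_sub_cancel, Nat.add_assoc, Nat.reduceAdd, 
    show p + 2 - 1 = p + 1 by omega, show q + 3 - 1 = q + 2 by omega,
    show r + 3 - 1 = r + 2 by omega, show q + 2 - 1 = q + 1 by omega,
    show r + 2 - 1 = r + 1 by omega] at h1 h2 h3 h4
  push_cast at h1 h2 h3 h4
  linear_combination (p + q + r + 6 : ℝ) * h1 + (p + 2 : ℝ) * h2 - (q + 3 : ℝ) * h3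
    - (r + 3 : ℝ) * h4

/-- If all three colours occur often, then the mean sign is exponentially small. -/
theorem abs_triMean_le_pow (s N j : ℕ) (p q r : ℕ) (hp : s + 3 * j ≤ p) (hq : s + 3 * j ≤ q)
    (hr : s + 3 * j ≤ r) (hN : p + q + r ≤ N) :
    |triMean p q r| ≤ (1 - 2 * s ^ 2 / N ^ 2 : ℝ) ^ j := by
  induction j generalizing p q r with
  | zero => simpa using abs_triMean_le_one p q r
  | succ j ih =>
    obtain ⟨p, rfl⟩ : ∃ p', p = p' + 3 := ⟨p - 3, by omega⟩
    obtain ⟨q, rfl⟩ : ∃ q', q = q' + 3 := ⟨q - 3, by omega⟩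
    obtain ⟨r, rfl⟩ : ∃ r', r = r' + 3 := ⟨r - 3, by omega⟩
    have e1 := abs_le.1 (ih (p + 1) (q + 1) (r + 3) (by omega) (by omega) (by omega) (by omega))
    have e2 := abs_le.1 (ih p (q + 2) (r + 3) (by omega) (by omega) (by omega) (by omega))
    have e3 := abs_le.1 (ih (p + 2) (q + 1) (r + 2) (by omega) (by omega) (by omega) (by omega))
    have e4 := abs_le.1 (ih (p + 2) (q + 2) (r + 1) (by omega) (by omega) (by omega) (by omega))
    have e5 := abs_le.1 (ih (p + 1) (q + 2) (r + 2) (by omega) (by omega) (by omega) (by omega))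
    have h := triMean_add_three p q r
    set X : ℝ := (1 - 2 * s ^ 2 / N ^ 2 : ℝ) ^ j with hX
    have hX0 : 0 ≤ X := by linarith [e1.1, e1.2]
    have hS : 0 < (p + q + r + 8 : ℝ) * (p + q + r + 6) := by positivity
    -- A double exposure takes at most three points from any colour, hence the reserve `s + 3 * j`.
    -- As `p + 2` and `r + 3` are at least `s`, the cancelled mass yields the factor `1 - 2 s² /
    -- N²`.
    have key : (p + q + r + 8 : ℝ) * (p + q + r + 6) * |triMean (p + 3) (q + 3) (r + 3)|
        ≤ ((p + q + r + 8 : ℝ) * (p + q + r + 6) - 2 * (p + 2) * (r + 3)) * X := by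
      rw [← abs_mul_of_pos_left hS, h, abs_le]
      have c1 : (0 : ℝ) ≤ (p + 2) * (q + 2) := by positivity
      have c2 : (0 : ℝ) ≤ (p + 2) * (p + 1) := by positivity
      have c3 : (0 : ℝ) ≤ (q + 3) * (q + 2) := by positivity
      have c4 : (0 : ℝ) ≤ (q + 3) * (r + 2) := by positivity
      have c5 : (0 : ℝ) ≤ (r + 3) * (r + 2) := by positivity
      have c6 : (0 : ℝ) ≤ (r + 3) * (q + 2) := by positivity
      have c7 : (0 : ℝ) ≤ (p + 2) * (q + 3) := by positivity
      constructor
      · linarith [mul_le_mul_of_nonneg_left e1.1 c1, mul_le_mul_of_nonneg_left e2.2 c2,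
          mul_le_mul_of_nonneg_left e3.1 c3, mul_le_mul_of_nonneg_left e4.2 c4,
          mul_le_mul_of_nonneg_left e4.1 c5, mul_le_mul_of_nonneg_left e3.2 c6,
          mul_le_mul_of_nonneg_left e5.1 c7]
      · linarith [mul_le_mul_of_nonneg_left e1.2 c1, mul_le_mul_of_nonneg_left e2.1 c2,
          mul_le_mul_of_nonneg_left e3.2 c3, mul_le_mul_of_nonneg_left e4.1 c4,
          mul_le_mul_of_nonneg_left e4.2 c5, mul_le_mul_of_nonneg_left e3.1 c6,
          mul_le_mul_of_nonneg_left e5.2 c7]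
    rw [← mul_le_mul_iff_right₀ hS]
    refine key.trans ?_
    rw [pow_succ, ← hX]
    have hps : (s : ℝ) ≤ p + 2 := by exact_mod_cast (by omega : s ≤ p + 2)
    have hrs : (s : ℝ) ≤ r + 3 := by exact_mod_cast (by omega : s ≤ r + 3)
    have hNS : (p + q + r + 8 : ℝ) * (p + q + r + 6) ≤ N ^ 2 := by
      have : (p + q + r + 9 : ℝ) ≤ N := by exact_mod_cast (by omega : p + q + r + 9 ≤ N)
      nlinarith
    have hs2 : (s : ℝ) ^ 2 ≤ (p + 2) * (r + 3) := by
      rw [sq]; exact mul_le_mul hps hrs (by positivity) (by positivity)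
    have hdiv : (p + q + r + 8 : ℝ) * (p + q + r + 6) * (2 * s ^ 2 / N ^ 2) ≤ 2 * s ^ 2 := by
      rw [mul_div_assoc', div_le_iff₀ (hS.trans_le hNS)]
      nlinarith [sq_nonneg (s : ℝ)]
    have : ((p + q + r + 8 : ℝ) * (p + q + r + 6) - 2 * (p + 2) * (r + 3)) ≤
        (p + q + r + 8 : ℝ) * (p + q + r + 6) * (1 - 2 * s ^ 2 / N ^ 2) := by
      linarith
    linarith [mul_le_mul_of_nonneg_right this hX0]

/-- Exposing a point of the rare colour leaves two large terms that nearly cancel when p and q are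
balanced. For p ≤ q they combine to `q - p` times one mean, plus p times a sum that lowers the rare
count once more. So one rare point costs D/M, or two together cost 3R/M, and θ has to dominate both.
The condition `r + M ≤ p + q` survives because p + q never falls by more than r does. -/
theorem triMean_right_bound_aux (R : ℕ) (M D θ : ℝ) (hM : 0 < M) (hθ : 0 ≤ θ)
    (hθ2 : D / M * θ + 3 * R / M ≤ θ ^ 2) (r : ℕ) (hr : r ≤ R) (p q : ℕ)
    (hD : |(p : ℝ) - q| ≤ D) (hpq : r + M ≤ p + q) : |triMean p q r| ≤ θ ^ r := by
  induction r using Nat.strong_induction_on generalizing p q with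
  | _ r ih =>
    wlog hle : p ≤ q generalizing p q
    · rw [triMean_swap_left]
      exact this q p (by rwa [abs_sub_comm]) (by linarith) (by omega)
    rcases r with _ | r
    · simpa using abs_triMean_le_one p q 0
    push_cast at hpq
    have hN : M ≤ (p + q + r : ℝ) := by linarith [Nat.cast_nonneg (α := ℝ) r]
    have hleR : (p : ℝ) ≤ q := by exact_mod_cast hle
    rw [abs_of_nonpos (by linarith)] at hD
    have hrec := triMean_rec_right p q r
    have b1 : (r : ℝ) * |triMean p q (r - 1)| ≤ r * θ ^ (r - 1) := by
      rcases r with _ | r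
      · simp
      · refine mul_le_mul_of_nonneg_left (ih r (by omega) (by omega) p q ?_ ?_) (by positivity)
        · rw [abs_of_nonpos (by linarith)]; exact hD
        · push_cast at hpq; linarith
    have b2 : ((q : ℝ) - p) * |triMean p (q - 1) r| ≤ D * θ ^ r := by
      rcases hle.eq_or_lt with rfl | hlt
      · rw [sub_self, zero_mul]
        have : 0 ≤ D := by linarith
        positivity
      · obtain ⟨q, rfl⟩ : ∃ q', q = q' + 1 := ⟨q - 1, by omega⟩
        have : (p : ℝ) ≤ q := by exact_mod_cast (by omega : p ≤ q)
        push_cast at *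
        refine mul_le_mul (by linarith) (ih r (by omega) (by omega) p q ?_ ?_) (abs_nonneg _)
          (by linarith)
        · rw [abs_of_nonpos (by linarith)]; linarith
        · linarith
    -- Adding the recursions for a point of the first and of the second colour cancels everything
    -- except the rare-colour term.
    have b3 : (p : ℝ) * |triMean (p - 1) q r + triMean p (q - 1) r| ≤ 2 * r * θ ^ (r - 1) := by
      rcases p with _ | p
      · simp only [Nat.cast_zero, zero_mul]; positivity
      obtain ⟨q, rfl⟩ : ∃ q', q = q' + 1 := ⟨q - 1, by omega⟩
      simp only [Nat.add_sub_cancel]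
      have i1 := triMean_rec_mid p q r
      have i2 := triMean_rec p q r
      have i3 : (p + q + r : ℝ) * (triMean p (q + 1) r + triMean (p + 1) q r)
          = -(2 * r * triMean p q (r - 1)) := by linarith
      rcases r with _ | r
      · have hpos : (0 : ℝ) < p + q ∨ (p + q : ℝ) = 0 := by
          rcases (by positivity : (0 : ℝ) ≤ p + q).lt_or_eq with h | h
          · exact Or.inl h
          · exact Or.inr h.symm
        rcases hpos with hpos | hpos
        · simp only [Nat.cast_zero, add_zero, mul_zero, zero_mul, neg_zero] at i3
          rcases mul_eq_zero.1 i3 with h | h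
          · exact absurd h hpos.ne'
          · rw [h]; simp
        · obtain ⟨rfl, rfl⟩ : p = 0 ∧ q = 0 := by
            have : p + q = 0 := by exact_mod_cast hpos
            omega
          rw [triMean_swap_left 0, triMean_one]
          simp
      · have hb := ih r (by omega) (by omega) p q
          (by rw [abs_of_nonpos (by push_cast at hleR; linarith)]; push_cast at hD; linarith)
          (by push_cast at hpq; linarith)
        have hpos : (0 : ℝ) < p + q + (r + 1 : ℕ) := by positivity
        simp only [Nat.add_sub_cancel] at i3 ⊢
        have i4 : (p + q + (r + 1 : ℕ) : ℝ) * |triMean p (q + 1) (r + 1) + triMean (p + 1) q (r + 1)|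
            ≤ 2 * (r + 1 : ℕ) * θ ^ r := by
          rw [← abs_mul_of_pos_left hpos, i3, abs_neg, abs_mul,
            abs_of_nonneg (by positivity : (0 : ℝ) ≤ 2 * (r + 1 : ℕ))]
          gcongr
        refine le_trans (mul_le_mul_of_nonneg_right ?_ (abs_nonneg _)) i4
        push_cast at hpq hleR ⊢
        linarith [Nat.cast_nonneg (α := ℝ) r, Nat.cast_nonneg (α := ℝ) p,
          Nat.cast_nonneg (α := ℝ) q]
    have htot : (p + q + r : ℝ) * |triMean p q (r + 1)| ≤ D * θ ^ r + 3 * r * θ ^ (r - 1) := by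
      rw [← abs_mul_of_pos_left (hM.trans_le hN), hrec,
        show r * triMean p q (r - 1) - p * triMean (p - 1) q r - q * triMean p (q - 1) r
          = r * triMean p q (r - 1) - (q - p) * triMean p (q - 1) r
            - p * (triMean (p - 1) q r + triMean p (q - 1) r) by ring]
      refine (abs_sub _ _).trans ((add_le_add_left (abs_sub _ _) _).trans ?_)
      rw [abs_mul, abs_mul, abs_mul, abs_of_nonneg (by linarith : (0 : ℝ) ≤ q - p),
        Nat.abs_cast, Nat.abs_cast]
      linarith
    have hfin : D * θ ^ r + 3 * r * θ ^ (r - 1) ≤ M * θ ^ (r + 1) := by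
      have h3 : D * θ + 3 * R ≤ M * θ ^ 2 := by
        have := mul_le_mul_of_nonneg_left hθ2 hM.le
        field_simp at this
        linarith
      rcases r with _ | r
      · simp only [pow_zero, Nat.cast_zero, mul_zero, zero_mul, add_zero, mul_one, zero_add, pow_one]
        have hR : (1 : ℝ) ≤ R := by exact_mod_cast (by omega : 1 ≤ R)
        have : 0 < θ := by
          rcases hθ.eq_or_lt with rfl | h
          · simp at h3; linarith
          · exact h
        nlinarith
      · have h4 : (r + 1 : ℝ) ≤ R := by exact_mod_cast (by omega : r + 1 ≤ R)
        have h5 : (0:ℝ) ≤ θ ^ r := by positivity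
        simp only [Nat.add_sub_cancel]
        push_cast
        calc D * θ ^ (r + 1) + 3 * (r + 1) * θ ^ r ≤ (D * θ + 3 * R) * θ ^ r := by
              rw [pow_succ]; nlinarith
          _ ≤ M * θ ^ 2 * θ ^ r := mul_le_mul_of_nonneg_right h3 h5
          _ = _ := by ring
    have : M * |triMean p q (r + 1)| ≤ M * θ ^ (r + 1) :=
      (mul_le_mul_of_nonneg_right hN (abs_nonneg _)).trans (htot.trans hfin)
    exact le_of_mul_le_mul_left this hM

/-- If one colour is rare and the others are balanced, then the mean sign is small. -/
theorem abs_triMean_le_of_rare (p q r : ℕ) (h : 8 * r ≤ p + q + r) :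
    |triMean p q r| ≤
      (2 * |(p : ℝ) - q| / (p + q + r : ℕ) + √(6 * r / (p + q + r : ℕ))) ^ r := by
  rcases Nat.eq_zero_or_pos (p + q + r) with h0 | hpos
  · obtain rfl : r = 0 := by omega
    simpa using abs_triMean_le_one p q 0
  set N : ℝ := ((p + q + r : ℕ) : ℝ) with hNdef
  have hN : 0 < N := by rw [hNdef]; exact_mod_cast hpos
  have hN' : N = p + q + r := by rw [hNdef]; push_cast; ring
  have hr : 8 * (r : ℝ) ≤ N := by rw [hNdef]; exact_mod_cast h
  -- With b = 2|p - q|/N and c = √(6r/N), the choice θ = b + c satisfies θ² ≥ bθ + c², the surplus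
  -- being bc.
  refine triMean_right_bound_aux r (N / 2) |(p : ℝ) - q| _ (by positivity) (by positivity) ?_ r le_rfl
    p q le_rfl (by linarith)
  have e1 : |(p : ℝ) - q| / (N / 2) = 2 * |(p : ℝ) - q| / N := by field_simp
  have e2 : 3 * (r : ℝ) / (N / 2) = √(6 * r / N) ^ 2 := by
    rw [Real.sq_sqrt (by positivity)]
    field_simp
    ring
  rw [e1, e2]
  have : 0 ≤ 2 * |(p : ℝ) - q| / N := by positivity
  nlinarith [mul_nonneg this (Real.sqrt_nonneg (6 * r / N))]

/-! ### The L² bound for the mean sign over all colourings -/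

theorem colorCount_insertNth {N : ℕ} (w : Fin (N + 1)) (i : Fin 3) (c : Fin N → Fin 3) :
    colorCount (w.insertNth i c : Fin (N + 1) → Fin 3) Finset.univ
      = colorCount c Finset.univ + Pi.single i 1 := by
  funext j
  simp only [colorCount, Finset.card_filter, Fin.sum_univ_succAbove _ w, Pi.add_apply,
    Fin.insertNth_apply_same, Fin.insertNth_apply_succAbove]
  rw [add_comm]
  congr 1
  by_cases h : i = j
  · subst h; simp
  · rw [if_neg h, Pi.single_eq_of_ne' h]

theorem sum_insertNth {N : ℕ} (w : Fin (N + 1)) (f : (Fin (N + 1) → Fin 3) → ℝ) :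
    ∑ c, f c = ∑ c : Fin N → Fin 3, ∑ i, f (w.insertNth i c) := by
  rw [← (Fin.insertNthEquiv (fun _ => Fin 3) w).sum_comp, Fintype.sum_prod_type_right]
  rfl

/-- The sign matrix is 2I - J, with eigenvalues 2, 2, -1; the deficit is the square of the sum of
the entries. -/
theorem sum_sq_pairSign_le (x : Fin 3 → ℝ) :
    ∑ i, (∑ j, x j * pairSign i j) ^ 2 ≤ 4 * ∑ j, x j ^ 2 := by
  simp only [Fin.sum_univ_three, pairSign]
  simp
  nlinarith [sq_nonneg (x 0 + x 1 + x 2)]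

theorem colorMean_single (i : Fin 3) : colorMean (Pi.single i 1) = 0 := by
  simp [colorMean, matchCount]

theorem sum_colorCount_sq_mul {V : Type*} (c : V → Fin 3) (s : Finset V) (h : Fin 3 → ℝ) :
    ∑ j, (colorCount c s j * h j) ^ 2 = ∑ w ∈ s, colorCount c s (c w) * h (c w) ^ 2 := by
  rw [sum_color_eq c s fun j => colorCount c s j * h j ^ 2]
  exact Finset.sum_congr rfl fun j _ => by ring

/-- Once `w` is deleted the argument of `f` no longer sees its colour. The three possible colours of
`w` contribute the remaining counts, each raised by one, with total M + 3. -/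
theorem sum_colorCount_mul_sq {M : ℕ} (f : (Fin 3 → ℕ) → ℝ) (w : Fin (M + 1)) :
    ∑ c : Fin (M + 1) → Fin 3, colorCount c Finset.univ (c w) *
        f (colorCount c Finset.univ - Pi.single (c w) 1) ^ 2
      = (M + 3) * ∑ c : Fin M → Fin 3, f (colorCount c Finset.univ) ^ 2 := by
  rw [sum_insertNth w, Finset.mul_sum]
  refine Finset.sum_congr rfl fun c _ => ?_
  simp only [colorCount_insertNth, Fin.insertNth_apply_same, add_tsub_cancel_right,
    Pi.add_apply, Pi.single_eq_same]
  rw [← Finset.sum_mul]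
  congr 1
  have := sum_colorCount c Finset.univ
  rw [Finset.card_univ, Fintype.card_fin] at this
  push_cast
  rw [Finset.sum_add_distrib, ← Nat.cast_sum, this]
  simp

/-- The recursion at one vertex applies the sign matrix, of squared norm 4, to the vector of the `k
j * colorMean (k - e_j)`. Two more points therefore multiply the sum by at most 4(M + 3)/(M + 1),
and these factors telescope. -/
theorem sum_colorMean_sq_fin (N : ℕ) :
    ∑ c : Fin N → Fin 3, colorMean (colorCount c Finset.univ) ^ 2 ≤ (N + 1) * 2 ^ N := by
  induction N using Nat.strong_induction_on with
  | _ N ih =>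
    match N with
    | 0 =>
      have : ∀ c : Fin 0 → Fin 3, colorCount c Finset.univ = 0 := fun c => by
        funext i; simp [colorCount]
      simp only [this, colorMean_zero]
      simp
    | 1 =>
      rw [sum_insertNth 0]
      have : ∀ c : Fin 0 → Fin 3, colorCount c Finset.univ = 0 := fun c => by
        funext i; simp [colorCount]
      simp only [colorCount_insertNth, this, zero_add, colorMean_single]
      simp
    | M + 2 =>
      have ihM := ih M (by omega)
      have step1 : ((M : ℝ) + 1) ^ 2 *
          ∑ c : Fin (M + 2) → Fin 3, colorMean (colorCount c Finset.univ) ^ 2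
          ≤ 4 * ∑ c : Fin (M + 1) → Fin 3, ∑ j, (colorCount c Finset.univ j *
            colorMean (colorCount c Finset.univ - Pi.single j 1)) ^ 2 := by
        rw [sum_insertNth 0, Finset.mul_sum, Finset.mul_sum]
        refine Finset.sum_le_sum fun c _ => ?_
        simp only [colorCount_insertNth]
        refine le_trans (le_of_eq ?_) (sum_sq_pairSign_le _)
        rw [Finset.mul_sum]
        refine Finset.sum_congr rfl fun i _ => ?_
        have h := colorMean_add_single (colorCount c Finset.univ) i
        rw [sum_colorCount, Finset.card_univ, Fintype.card_fin] at h
        push_cast at h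
        rw [← mul_pow, h]
        congr 1
        exact Finset.sum_congr rfl fun j _ => by ring
      have step2 : ∑ c : Fin (M + 1) → Fin 3, ∑ j, (colorCount c Finset.univ j *
            colorMean (colorCount c Finset.univ - Pi.single j 1)) ^ 2
          = (M + 1) * (M + 3) * ∑ c : Fin M → Fin 3, colorMean (colorCount c Finset.univ) ^ 2 := by
        refine (Finset.sum_congr rfl fun c _ => sum_colorCount_sq_mul c Finset.univ
          fun j => colorMean (colorCount c Finset.univ - Pi.single j 1)).trans ?_
        rw [Finset.sum_comm]
        refine (Finset.sum_congr rfl fun w _ => sum_colorCount_mul_sq colorMean w).trans ?_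
        rw [Finset.sum_const, Finset.card_univ, Fintype.card_fin, nsmul_eq_mul]
        push_cast
        ring
      rw [step2] at step1
      have hM : (0 : ℝ) < (M + 1) ^ 2 := by positivity
      refine le_of_mul_le_mul_left (step1.trans ?_) hM
      push_cast
      calc 4 * ((M + 1) * (M + 3) * ∑ c : Fin M → Fin 3, colorMean (colorCount c Finset.univ) ^ 2)
          ≤ 4 * ((M + 1) * (M + 3) * ((M + 1) * 2 ^ M)) := by gcongr
        _ = _ := by ring

theorem colorCount_comp_equiv {V V' : Type*} [Fintype V] [Fintype V'] (e : V ≃ V')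
    (c : V' → Fin 3) : colorCount (c ∘ e) Finset.univ = colorCount c Finset.univ := by
  funext i
  simp only [colorCount, Finset.card_filter]
  exact e.sum_comp fun v => if c v = i then 1 else 0

/-- The mean over all colourings of the square of the mean sign is of polynomial size. -/
theorem sum_colorMean_sq (V : Type*) [Fintype V] [DecidableEq V] :
    ∑ c : V → Fin 3, colorMean (colorCount c Finset.univ) ^ 2
      ≤ (Fintype.card V + 1) * 2 ^ Fintype.card V := by
  refine le_trans (le_of_eq ?_) (sum_colorMean_sq_fin _)
  rw [← ((Fintype.equivFin V).arrowCongr (Equiv.refl (Fin 3))).symm.sum_comp]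
  refine Finset.sum_congr rfl fun c _ => ?_
  rw [← colorCount_comp_equiv (Fintype.equivFin V)]
  rfl

/-! ### Averaging the second moment over the angles -/

/-- The uniform distribution of one angle. -/
def circleMeasure : Measure ℝ := cond volume (Set.Ico 0 (2 * Real.pi))

instance : IsProbabilityMeasure circleMeasure :=
  cond_isProbabilityMeasure_of_finite (by simp [Real.volume_Ico, Real.pi_pos])
    (by rw [Real.volume_Ico]; exact ENNReal.ofReal_ne_top)

theorem integral_circleMeasure_exp (k : ℤ) :
    ∫ t, Complex.exp (k * t * Complex.I) ∂circleMeasure = if k = 0 then 1 else 0 := by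
  split_ifs with h
  · simp [h]
  · have hpi : (0 : ℝ) ≤ 2 * Real.pi := by positivity
    have hk : (k : ℂ) * Complex.I ≠ 0 := mul_ne_zero (by exact_mod_cast h) Complex.I_ne_zero
    rw [circleMeasure, ProbabilityTheory.cond, integral_smul_measure, integral_Ico_eq_integral_Ioc,
      ← intervalIntegral.integral_of_le hpi]
    have : ∀ t : ℝ, (k : ℂ) * t * Complex.I = (k * Complex.I) * t := fun t => by ring
    simp only [this]
    rw [integral_exp_mul_complex hk]
    have h1 : Complex.exp ((k * Complex.I) * ((2 * Real.pi : ℝ) : ℂ)) = 1 := by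
      rw [Complex.exp_eq_one_iff]
      exact ⟨k, by push_cast; ring⟩
    rw [h1]
    simp

/-- A quadruple of computational basis labels of one qubit. -/
abbrev BoolQuad : Type := (Bool × Bool) × (Bool × Bool)

/-- The coefficient of the angle in the phase of a quadruple. -/
def quadCharge (w : BoolQuad) : ℤ :=
  w.1.2.toInt - w.1.1.toInt + (w.2.2.toInt - w.2.1.toInt)

/-- The colour of a quadruple. -/
def quadColor (w : BoolQuad) : Fin 3 :=
  if w.1.1 = w.2.1 then 0 else if w.1.1 = w.1.2 then 1 else 2

/-- The contribution of one qubit to the second moment, summed over its outcomes. -/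
def quadPhase (t : ℝ) (w : BoolQuad) : ℂ :=
  ∑ b, (starRingEnd ℂ (xyQubit t b w.1.1) * xyQubit t b w.1.2)
    * (starRingEnd ℂ (xyQubit t b w.2.1) * xyQubit t b w.2.2)

theorem sqrt_two_mul_sqrt_two : ((√2 : ℝ) : ℂ) * ((√2 : ℝ) : ℂ) = 2 := by
  rw [← Complex.ofReal_mul, Real.mul_self_sqrt (by norm_num)]; norm_num

theorem conj_xyQubit_mul (t : ℝ) (b u v : Bool) :
    starRingEnd ℂ (xyQubit t b u) * xyQubit t b v
      = (if b then (-1) ^ (v.toInt - u.toInt) else 1) / 2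
        * Complex.exp ((v.toInt - u.toInt : ℤ) * t * Complex.I) := by
  have h : Complex.exp (Complex.I * t) * Complex.exp (-(Complex.I * t)) = 1 := by
    rw [← Complex.exp_add]; simp
  have hconj : starRingEnd ℂ (Complex.exp (Complex.I * t)) = Complex.exp (-(Complex.I * t)) := by
    rw [← Complex.exp_conj]; simp
  have e1 : Complex.exp (t * Complex.I) = Complex.exp (Complex.I * t) := by rw [mul_comm]
  have e2 : Complex.exp (-(t * Complex.I)) = Complex.exp (-(Complex.I * t)) := by rw [mul_comm]
  unfold xyQubit
  rw [map_div₀, div_mul_div_comm, Complex.conj_ofReal, sqrt_two_mul_sqrt_two]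
  cases b <;> cases u <;> cases v <;> simp [Bool.toInt, hconj, e1, e2] <;>
    generalize Complex.exp (Complex.I * t) = X at * <;>
    generalize Complex.exp (-(Complex.I * t)) = Y at * <;>
    first
      | ring1
      | linear_combination h / 2

/-- The sum over outcomes kills odd charges; the angle integral then leaves charge 0 only, with
weight 2/4. -/
theorem quadPhase_eq (t : ℝ) (w : BoolQuad) :
    quadPhase t w = (1 + (-1) ^ quadCharge w) / 4 * Complex.exp (quadCharge w * t * Complex.I) := by
  obtain ⟨⟨u, v⟩, ⟨u', v'⟩⟩ := w
  unfold quadPhase quadCharge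
  simp only [conj_xyQubit_mul, Fintype.sum_bool, if_true, Bool.false_eq_true, if_false]
  rw [zpow_add₀ (by norm_num)]
  push_cast
  simp only [add_mul, Complex.exp_add]
  ring

theorem integral_quadPhase (w : BoolQuad) :
    ∫ t, quadPhase t w ∂circleMeasure = if quadCharge w = 0 then 1 / 2 else 0 := by
  simp only [quadPhase_eq, integral_const_mul, integral_circleMeasure_exp]
  split_ifs with h
  · rw [h]; norm_num
  · simp

theorem integrable_quadPhase (w : BoolQuad) : Integrable (fun t => quadPhase t w) circleMeasure := by
  simp only [quadPhase_eq]
  refine Integrable.const_mul (Integrable.of_bound (C := 1) ?_ ?_) _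
  · exact (by fun_prop : Continuous fun t : ℝ =>
      Complex.exp (quadCharge w * t * Complex.I)).aestronglyMeasurable
  · refine Filter.Eventually.of_forall fun t => ?_
    rw [show (quadCharge w : ℂ) * t * Complex.I = ((quadCharge w * t : ℝ) : ℂ) * Complex.I by
      push_cast; ring, Complex.norm_exp_ofReal_mul_I]

theorem sum_pi_mul_sum_pi {ι α β R : Type*} [Fintype ι] [DecidableEq ι] [Fintype α] [Fintype β]
    [CommSemiring R] (f : (ι → α) → R) (g : (ι → β) → R) :
    (∑ z, f z) * ∑ y, g y = ∑ w : ι → α × β, f (fun i => (w i).1) * g fun i => (w i).2 := by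
  rw [Finset.sum_mul_sum, ← Fintype.sum_prod_type', ← (Equiv.arrowProdEquivProdArrow ι _ _).sum_comp]
  rfl

/-- The sign of the `CZ` gates of a multigraph at a computational basis state. -/
def czSign {n : ℕ} (G : Multigraph n) (z : Fin n → Bool) : ℂ := (G.map fun e => czPhase e z).prod

theorem conj_czSign {n : ℕ} (G : Multigraph n) (z : Fin n → Bool) :
    starRingEnd ℂ (czSign G z) = czSign G z := by
  rw [czSign, map_multiset_prod, Multiset.map_map]
  congr 1
  refine Multiset.map_congr rfl fun e _ => ?_
  simp only [Function.comp, czPhase]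
  split_ifs <;> simp

theorem inner_xyBasisVector_graphState {n : ℕ} (G : Multigraph n) (θ : Fin n → ℝ)
    (x : Fin n → Bool) :
    inner ℂ (xyBasisVector θ x) (graphState G) = ((√(2 ^ n) : ℝ) : ℂ)⁻¹ *
      ∑ z : Fin n → Bool, czSign G z * ∏ j, starRingEnd ℂ (xyQubit (θ j) (x j) (z j)) := by
  rw [PiLp.inner_apply, Finset.mul_sum]
  refine Finset.sum_congr rfl fun z _ => ?_
  simp only [RCLike.inner_apply, xyBasisVector, graphState, map_prod, czSign]
  ring

/-- The product of the signs of the four basis states of a configuration of quadruples. -/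
def quadSign {n : ℕ} (G : Multigraph n) (w : Fin n → BoolQuad) : ℂ :=
  (czSign G (fun i => (w i).1.1) * czSign G (fun i => (w i).1.2)) *
    (czSign G (fun i => (w i).2.1) * czSign G (fun i => (w i).2.2))

theorem outcomeProb_eq {n : ℕ} (G : Multigraph n) (θ : Fin n → ℝ) (x : Fin n → Bool) :
    (outcomeProb G θ x : ℂ) = (2 ^ n)⁻¹ * ∑ w : Fin n → Bool × Bool,
      (czSign G (fun i => (w i).1) * czSign G (fun i => (w i).2)) *
        ∏ j, (starRingEnd ℂ (xyQubit (θ j) (x j) (w j).1) * xyQubit (θ j) (x j) (w j).2) := by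
  have hs : ((√(2 ^ n) : ℝ) : ℂ) * ((√(2 ^ n) : ℝ) : ℂ) = 2 ^ n := by
    rw [← Complex.ofReal_mul, Real.mul_self_sqrt (by positivity)]; push_cast; rfl
  rw [outcomeProb, Complex.ofReal_pow, ← Complex.mul_conj', inner_xyBasisVector_graphState, map_mul,
    map_inv₀, Complex.conj_ofReal, mul_mul_mul_comm, ← mul_inv, hs, map_sum, sum_pi_mul_sum_pi]
  congr 1
  refine Finset.sum_congr rfl fun w _ => ?_
  rw [map_mul, conj_czSign, map_prod, Finset.prod_mul_distrib]
  simp only [Complex.conj_conj]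
  ring

theorem secondMoment_eq {n : ℕ} (G : Multigraph n) (θ : Fin n → ℝ) :
    (secondMoment G θ : ℂ) = (2 ^ n)⁻¹ *
      ∑ w : Fin n → BoolQuad, quadSign G w * ∏ j, quadPhase (θ j) (w j) := by
  rw [secondMoment]
  push_cast
  have h : ∀ x : Fin n → Bool, (outcomeProb G θ x : ℂ) ^ 2 = ((2 ^ n)⁻¹ * (2 ^ n)⁻¹) *
      ∑ w : Fin n → BoolQuad, quadSign G w * ∏ j,
        ((starRingEnd ℂ (xyQubit (θ j) (x j) (w j).1.1) * xyQubit (θ j) (x j) (w j).1.2)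
        * (starRingEnd ℂ (xyQubit (θ j) (x j) (w j).2.1) * xyQubit (θ j) (x j) (w j).2.2)) := by
    intro x
    rw [sq, outcomeProb_eq, mul_mul_mul_comm, sum_pi_mul_sum_pi]
    congr 1
    refine Finset.sum_congr rfl fun w _ => ?_
    rw [mul_mul_mul_comm, ← Finset.prod_mul_distrib, quadSign]
  rw [Finset.sum_congr rfl fun x _ => h x, ← Finset.mul_sum, Finset.sum_comm, ← mul_assoc]
  congr 1
  · field_simp
  · refine Finset.sum_congr rfl fun w _ => ?_
    rw [← Finset.mul_sum]
    congr 1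
    simp only [quadPhase]
    rw [Finset.prod_univ_sum, Fintype.piFinset_univ]

theorem integral_secondMoment_eq_sum {n : ℕ} (G : Multigraph n) :
    ((∫ θ, secondMoment G θ ∂angleMeasure n : ℝ) : ℂ) = (2 ^ n)⁻¹ *
      ∑ w : Fin n → BoolQuad, quadSign G w * ∏ j, if quadCharge (w j) = 0 then 1 / 2 else 0 := by
  rw [← integral_complex_ofReal]
  simp only [secondMoment_eq]
  rw [integral_const_mul]
  congr 1
  change ∫ θ, _ ∂(Measure.pi fun _ => circleMeasure) = _
  rw [integral_finsetSum]
  · refine Finset.sum_congr rfl fun w _ => ?_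
    rw [integral_const_mul, integral_fintype_prod_eq_prod (fun j t => quadPhase t (w j))]
    simp only [integral_quadPhase]
  · intro w _
    exact (Integrable.fintype_prod (fun j => integrable_quadPhase (w j))).const_mul _

theorem czPhase_mk {n : ℕ} {a b : Fin n} (h : a ≠ b) (z : Fin n → Bool) :
    czPhase s(a, b) z = if z a = true ∧ z b = true then -1 else 1 := by
  simp [czPhase, h]

theorem cutSign_of_eq {V : Type*} {c : V → Fin 3} {a b : V} (h : s(c a, c b) = s(1, 2)) :
    cutSign c s(a, b) = -1 := if_pos h

theorem cutSign_of_ne {V : Type*} {c : V → Fin 3} {a b : V} (h : s(c a, c b) ≠ s(1, 2)) :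
    cutSign c s(a, b) = 1 := if_neg h

/-- At charge 0, colour 0 means that all four labels agree, colour 1 that each ket equals its own
bra and the bras differ, colour 2 that the kets are exchanged. The sign is the parity of the four
products of labels, a finite check. -/
theorem quadSign_singleton {n : ℕ} (e : Sym2 (Fin n)) (w : Fin n → BoolQuad)
    (hw : ∀ j, quadCharge (w j) = 0) :
    (czPhase e (fun i => (w i).1.1) * czPhase e (fun i => (w i).1.2)) *
      (czPhase e (fun i => (w i).2.1) * czPhase e (fun i => (w i).2.2))
      = (cutSign (fun j => quadColor (w j)) e : ℂ) := by
  have key : ∀ x y : BoolQuad, quadCharge x = 0 → quadCharge y = 0 →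
      ((if x.1.1 ∧ y.1.1 then -1 else 1) * (if x.1.2 ∧ y.1.2 then -1 else 1)) *
      ((if x.2.1 ∧ y.2.1 then -1 else 1) * (if x.2.2 ∧ y.2.2 then -1 else 1)) =
      (if s(quadColor x, quadColor y) = s(1, 2) then -1 else 1 : ℤ) := by
    decide
  induction e with
  | _ a b =>
    by_cases hab : a = b
    · subst hab
      have : s(quadColor (w a), quadColor (w a)) ≠ s(1, 2) := by
        generalize quadColor (w a) = i
        revert i
        decide
      rw [cutSign_of_ne (c := fun j => quadColor (w j)) this]
      simp [czPhase]
    · have h := congrArg (fun t : ℤ => (t : ℂ)) (key (w a) (w b) (hw a) (hw b))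
      simp only [czPhase_mk hab]
      push_cast at h
      rw [h]
      split_ifs with hc
      · rw [cutSign_of_eq (c := fun j => quadColor (w j)) hc]; simp
      · rw [cutSign_of_ne (c := fun j => quadColor (w j)) hc]; simp

theorem quadSign_eq {n : ℕ} (G : Multigraph n) (w : Fin n → BoolQuad)
    (hw : ∀ j, quadCharge (w j) = 0) :
    quadSign G w = ((G.map (cutSign fun j => quadColor (w j))).prod : ℝ) := by
  induction G using Multiset.induction_on with
  | empty => simp [quadSign, czSign]
  | cons e G ih =>
    rw [Multiset.map_cons, Multiset.prod_cons, Complex.ofReal_mul, ← ih,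
      ← quadSign_singleton e w hw]
    simp only [quadSign, czSign, Multiset.map_cons, Multiset.prod_cons]
    ring

/-- The second moment, averaged over the angles, as a sum over colourings. -/
theorem integral_secondMoment {n : ℕ} (G : Multigraph n) :
    ∫ θ, secondMoment G θ ∂angleMeasure n
      = (2 ^ n)⁻¹ * ∑ c : Fin n → Fin 3, (G.map (cutSign c)).prod := by
  apply Complex.ofReal_injective
  rw [integral_secondMoment_eq_sum]
  push_cast
  congr 1
  have h1 : ∀ w : Fin n → BoolQuad,
      quadSign G w * ∏ j, (if quadCharge (w j) = 0 then (1 / 2 : ℂ) else 0)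
      = ∑ c : Fin n → Fin 3, (((G.map (cutSign c)).prod : ℝ) : ℂ) *
        ∏ j, if quadCharge (w j) = 0 ∧ quadColor (w j) = c j then (1 / 2 : ℂ) else 0 := by
    intro w
    by_cases hw : ∀ j, quadCharge (w j) = 0
    · rw [Finset.sum_eq_single fun j => quadColor (w j)]
      · rw [quadSign_eq G w hw]
        simp
      · intro c _ hc
        obtain ⟨j, hj⟩ := Function.ne_iff.1 hc
        rw [Finset.prod_eq_zero (Finset.mem_univ j), mul_zero]
        rw [if_neg]
        exact fun h => hj h.2.symm
      · simp
    · push Not at hw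
      obtain ⟨j, hj⟩ := hw
      rw [Finset.prod_eq_zero (Finset.mem_univ j) (by simp [hj]), mul_zero]
      symm
      refine Finset.sum_eq_zero fun c _ => ?_
      rw [Finset.prod_eq_zero (Finset.mem_univ j) (by simp [hj]), mul_zero]
  -- Each colour has two quadruples of charge 0, complementary to each other, each of weight 1/2.
  have h2 : ∀ i : Fin 3, ∑ q : BoolQuad,
      (if quadCharge q = 0 ∧ quadColor q = i then (1 / 2 : ℂ) else 0) = 1 := by
    intro i
    rw [← Finset.sum_filter, Finset.sum_const]
    have : (Finset.univ.filter fun q : BoolQuad => quadCharge q = 0 ∧ quadColor q = i).card = 2 := by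
      revert i; decide
    rw [this]
    norm_num
  rw [Finset.sum_congr rfl fun w _ => h1 w, Finset.sum_comm]
  refine Finset.sum_congr rfl fun c _ => ?_
  rw [← Finset.mul_sum]
  have h3 := Finset.prod_univ_sum (fun _ : Fin n => (Finset.univ : Finset BoolQuad))
    (fun j q => if quadCharge q = 0 ∧ quadColor q = c j then (1 / 2 : ℂ) else 0)
  rw [Fintype.piFinset_univ] at h3
  rw [← h3, Finset.prod_congr rfl fun j _ => h2 (c j), Finset.prod_const_one, mul_one]

/-! ### Averaging over the random graph -/

/-- The mean over all perfect matchings of the sign given by the edges between the colours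
`1` and `2`. -/
def cutMean {V : Type*} [Fintype V] (c : V → Fin 3) : ℝ :=
  matchSum (cutSign c) Finset.univ / matchCount (Fintype.card V)

theorem cutSign_mk {V : Type*} (c : V → Fin 3) (v w : V) :
    cutSign c s(v, w) = if s(c v, c w) = s(1, 2) then -1 else 1 := by
  split_ifs with h
  · exact cutSign_of_eq h
  · exact cutSign_of_ne h

/-- The two edge signs differ by a factor -1 for each end of colour 0. This is a vertex weight, so
it leaves the matching sum as a global sign; passing to `colorMean` makes the three colours
symmetric. -/
theorem abs_cutMean {V : Type*} [Fintype V] (c : V → Fin 3) :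
    |cutMean c| = |colorMean (colorCount c Finset.univ)| := by
  have h : ∀ i j : Fin 3, (if s(i, j) = s(1, 2) then -1 else 1 : ℤ)
      = (if i = 0 then -1 else 1) * (if j = 0 then -1 else 1) * (if i = j then 1 else -1) := by
    decide
  rw [cutMean, matchSum_mul_prod (K := colorSign c) (g := fun v => if c v = 0 then -1 else 1),
    mul_div_assoc, abs_mul, ← Finset.card_univ, matchSum_colorSign_div, Finset.abs_prod]
  · rw [Finset.prod_eq_one, one_mul]
    intro v _
    split_ifs <;> simp
  · intro v w _
    rw [cutSign_mk, colorSign_mk, pairSign]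
    exact_mod_cast h (c v) (c w)

theorem cutMean_of_prod {V : Type*} [Fintype V] (hV : Even (Fintype.card V)) (c : V → Fin 3)
    (g : V → ℝ) (h : ∀ v w, (if s(c v, c w) = s(1, 2) then -1 else 1 : ℝ) = g v * g w) :
    cutMean c = ∏ v, g v := by
  rw [cutMean, matchSum_mul_prod (K := fun _ => 1) (g := g), matchSum_one, Finset.card_univ,
    mul_div_assoc, div_self (matchCount_pos hV).ne', mul_one]
  intro v w _
  rw [cutSign_mk, h, mul_one]

theorem cutMean_eq_one {V : Type*} [Fintype V] (hV : Even (Fintype.card V)) (c : V → Fin 3)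
    (h : (∀ v, c v ≠ 1) ∨ ∀ v, c v ≠ 2) : cutMean c = 1 := by
  rw [cutMean_of_prod hV c fun _ => 1]
  · simp
  · intro v w
    rw [if_neg, one_mul]
    simp only [Sym2.eq_iff]
    rcases h with h | h
    · have := h v; have := h w; tauto
    · have := h v; have := h w; tauto

/-- Without colour 0 the edge sign is itself a product of vertex signs, so all matchings have the
same sign. -/
theorem cutMean_eq_prod {V : Type*} [Fintype V] (hV : Even (Fintype.card V)) (c : V → Fin 3)
    (h : ∀ v, c v ≠ 0) : cutMean c = ∏ v, if c v = 1 then -1 else 1 := by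
  refine cutMean_of_prod hV c _ fun v w => ?_
  have key : ∀ i j : Fin 3, i ≠ 0 → j ≠ 0 → (if s(i, j) = s(1, 2) then -1 else 1 : ℤ)
      = (if i = 1 then -1 else 1) * (if j = 1 then -1 else 1) := by decide
  exact_mod_cast key (c v) (c w) (h v) (h w)

theorem expect_pi_prod {α : Type*} [Fintype α] (d : ℕ) (f : α → ℝ) :
    (𝔼 M : Fin d → α, ∏ k, f (M k)) = (𝔼 a, f a) ^ d := by
  classical
  rw [Fintype.expect_eq_sum_div_card, Fintype.expect_eq_sum_div_card, div_pow]
  congr 1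
  · have := Finset.prod_univ_sum (fun _ : Fin d => (Finset.univ : Finset α)) (fun _ a => f a)
    rw [Fintype.piFinset_univ] at this
    rw [← this]
    simp
  · simp

theorem matchingSecondMoment_eq (n d : ℕ) :
    matchingSecondMoment n d = (2 ^ n)⁻¹ * ∑ c : Fin n → Fin 3, cutMean c ^ d := by
  rw [matchingSecondMoment]
  simp only [integral_secondMoment, ← Finset.mul_expect]
  rw [Finset.expect_sum_comm]
  congr 1
  refine Finset.sum_congr rfl fun c _ => ?_
  rw [cutMean, ← expect_perfectMatching, ← expect_pi_prod]
  refine Finset.expect_congr rfl fun M _ => ?_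
  rw [matchingMultigraph, ← Multiset.coe_mapAddMonoidHom, map_sum, Multiset.prod_sum]

theorem pairingSecondMoment_eq (n d : ℕ) :
    pairingSecondMoment n d
      = (2 ^ n)⁻¹ * ∑ c : Fin n → Fin 3, cutMean (fun v : Fin n × Fin d => c v.1) := by
  rw [pairingSecondMoment]
  simp only [integral_secondMoment, ← Finset.mul_expect]
  rw [Finset.expect_sum_comm]
  congr 1
  refine Finset.sum_congr rfl fun c _ => ?_
  rw [cutMean, ← expect_perfectMatching]
  refine Finset.expect_congr rfl fun M _ => ?_
  rw [pairingMultigraph, Multiset.map_map]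
  congr 1
  refine Multiset.map_congr rfl fun e _ => ?_
  simp only [Function.comp, cutSign, Sym2.map_map]

/-! ### Main term: colourings that miss a colour -/

theorem sum_prod_color (n : ℕ) (g : Fin 3 → ℝ) :
    ∑ c : Fin n → Fin 3, ∏ j, g (c j) = (g 0 + g 1 + g 2) ^ n := by
  have := Finset.prod_univ_sum (fun _ : Fin n => (Finset.univ : Finset (Fin 3))) (fun _ a => g a)
  rw [Fintype.piFinset_univ] at this
  rw [← this]
  simp [Fin.sum_univ_three]

open Classical in
/-- The contribution of the colourings in which some colour does not occur. -/
theorem abs_sum_sub_le {n d : ℕ} (hn : n ≠ 0) (φ : (Fin n → Fin 3) → ℝ)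
    (h12 : ∀ c, ((∀ v, c v ≠ 1) ∨ ∀ v, c v ≠ 2) → φ c = 1)
    (h0 : ∀ c, (∀ v, c v ≠ 0) → φ c = ∏ v, if c v = 1 then (-1) ^ d else 1) :
    |(2 ^ n)⁻¹ * ∑ c, φ c - (if Odd d then 2 else 3)| ≤ 3 * (2 ^ n)⁻¹ +
      (2 ^ n)⁻¹ * ∑ c with (∀ i, ∃ v, c v = i), |φ c| := by
  -- `m i` indicates that colour `i` is missing. It is a product over vertices, so the single and
  -- double terms of inclusion-exclusion follow from `sum_prod_color`.
  set w : Fin 3 → Fin 3 → ℝ := fun i j => if j = i then 0 else 1 with hw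
  set m : Fin 3 → (Fin n → Fin 3) → ℝ := fun i c => ∏ v, w i (c v) with hm
  have m1 : ∀ i c, (∀ v, c v ≠ i) → m i c = 1 := fun i c h => by
    simp [hm, hw, h]
  have m0 : ∀ i c, (¬ ∀ v, c v ≠ i) → m i c = 0 := fun i c h => by
    push Not at h
    obtain ⟨v, hv⟩ := h
    exact Finset.prod_eq_zero (Finset.mem_univ v) (by simp [hw, hv])
  have e1 : ∀ c, m 1 c * φ c = m 1 c := fun c => by
    by_cases h : ∀ v, c v ≠ 1
    · rw [h12 c (Or.inl h), mul_one]
    · rw [m0 1 c h, zero_mul]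
  have e2 : ∀ c, m 2 c * φ c = m 2 c := fun c => by
    by_cases h : ∀ v, c v ≠ 2
    · rw [h12 c (Or.inr h), mul_one]
    · rw [m0 2 c h, zero_mul]
  have e0 : ∀ c, m 0 c * φ c =
      ∏ v, (fun i : Fin 3 => w 0 i * if i = 1 then (-1 : ℝ) ^ d else 1) (c v) := fun c => by
    simp only [Finset.prod_mul_distrib]
    change _ = m 0 c * _
    by_cases h : ∀ v, c v ≠ 0
    · rw [h0 c h]
    · rw [m0 0 c h, zero_mul, zero_mul]
  have s1 : ∑ c, m 1 c * φ c = 2 ^ n := by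
    simp only [e1]
    rw [sum_prod_color n (w 1)]
    congr 1
    simp [hw]
    norm_num
  have s2 : ∑ c, m 2 c * φ c = 2 ^ n := by
    simp only [e2]
    rw [sum_prod_color n (w 2)]
    congr 1
    simp [hw]
    norm_num
  -- The parity of d enters here, through (0 + (-1)^d + 1)^n.
  have s0 : ∑ c, m 0 c * φ c = if Odd d then 0 else 2 ^ n := by
    refine (Finset.sum_congr rfl fun c _ => e0 c).trans
      ((sum_prod_color n fun i => w 0 i * if i = 1 then (-1 : ℝ) ^ d else 1).trans ?_)
    by_cases h : Odd d
    · rw [if_pos h]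
      simp [hw, h.neg_one_pow, hn]
    · rw [if_neg h]
      rw [Nat.not_odd_iff_even] at h
      congr 1
      simp [hw, h.neg_one_pow]
      norm_num
  have hmul : ∀ i j c, m i c * m j c = ∏ v, (fun x => w i x * w j x) (c v) := fun i j c =>
    Finset.prod_mul_distrib.symm
  have s01 : ∑ c, m 0 c * (m 1 c * φ c) = 1 := by
    simp only [e1]
    refine (Finset.sum_congr rfl fun c _ => hmul 0 1 c).trans
      ((sum_prod_color n fun x => w 0 x * w 1 x).trans ?_)
    simp [hw]
  have s02 : ∑ c, m 0 c * (m 2 c * φ c) = 1 := by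
    simp only [e2]
    refine (Finset.sum_congr rfl fun c _ => hmul 0 2 c).trans
      ((sum_prod_color n fun x => w 0 x * w 2 x).trans ?_)
    simp [hw]
  have s12 : ∑ c, m 1 c * (m 2 c * φ c) = 1 := by
    simp only [e2]
    refine (Finset.sum_congr rfl fun c _ => hmul 1 2 c).trans
      ((sum_prod_color n fun x => w 1 x * w 2 x).trans ?_)
    simp [hw]
  have s012 : ∑ c, m 0 c * (m 1 c * (m 2 c * φ c)) = 0 := by
    refine Finset.sum_eq_zero fun c _ => ?_
    rcases Nat.exists_eq_succ_of_ne_zero hn with ⟨k, rfl⟩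
    by_cases h : c 0 = 0
    · rw [m0 0 c (by push Not; exact ⟨0, h⟩), zero_mul]
    · by_cases h' : c 0 = 1
      · rw [m0 1 c (by push Not; exact ⟨0, h'⟩), zero_mul, mul_zero]
      · rw [m0 2 c (by push Not; exact ⟨0, by omega⟩), zero_mul, mul_zero, mul_zero]
  have hrest : ∑ c with (∀ i, ∃ v, c v = i), φ c
      = ∑ c, φ c - ∑ c, m 0 c * φ c - ∑ c, m 1 c * φ c - ∑ c, m 2 c * φ c
        + ∑ c, m 0 c * (m 1 c * φ c) + ∑ c, m 0 c * (m 2 c * φ c) + ∑ c, m 1 c * (m 2 c * φ c)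
        - ∑ c, m 0 c * (m 1 c * (m 2 c * φ c)) := by
    simp only [← Finset.sum_sub_distrib, ← Finset.sum_add_distrib]
    rw [Finset.sum_filter]
    refine Finset.sum_congr rfl fun c _ => ?_
    split_ifs with h
    · rw [m0 0 c (by simpa using h 0), m0 1 c (by simpa using h 1), m0 2 c (by simpa using h 2)]
      ring
    · push Not at h
      obtain ⟨i, hi⟩ := h
      have := m1 i c hi
      fin_cases i
      · simp only [Fin.zero_eta] at this
        rw [this]; ring
      · simp only [Fin.mk_one] at this
        rw [this]; ring
      · simp only [Fin.reduceFinMk] at this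
        rw [this]; ring
  rw [s0, s1, s2, s01, s02, s12, s012] at hrest
  have h2 : (2 ^ n : ℝ)⁻¹ * 2 ^ n = 1 := inv_mul_cancel₀ (by positivity)
  have hpos : (0 : ℝ) < (2 ^ n)⁻¹ := by positivity
  have habs : |∑ c with (∀ i, ∃ v, c v = i), φ c| ≤ ∑ c with (∀ i, ∃ v, c v = i), |φ c| :=
    Finset.abs_sum_le_sum_abs _ _
  have hmain : (2 ^ n)⁻¹ * ∑ c, φ c - (if Odd d then 2 else 3)
      = (2 ^ n)⁻¹ * (∑ c with (∀ i, ∃ v, c v = i), φ c) - 3 * (2 ^ n)⁻¹ := by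
    rw [hrest]
    split_ifs
    · linear_combination 2 * h2
    · linear_combination 3 * h2
  rw [hmain]
  refine (abs_sub _ _).trans ?_
  rw [abs_mul, abs_of_pos hpos, abs_of_pos (by positivity : (0 : ℝ) < 3 * (2 ^ n)⁻¹), add_comm]
  gcongr

/-! ### Colourings with a rare colour -/

theorem prod_color_eq {V : Type*} (c : V → Fin 3) (s : Finset V) (g : Fin 3 → ℝ) :
    ∏ v ∈ s, g (c v) = ∏ i, g i ^ colorCount c s i := by
  rw [← Finset.prod_fiberwise s c]
  refine Finset.prod_congr rfl fun i _ => ?_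
  rw [Finset.prod_congr rfl (g := fun _ => g i)
    (fun v hv => by rw [(Finset.mem_filter.1 hv).2]), Finset.prod_const]
  rfl

theorem univ_fin_three_of_ne {i j l : Fin 3} (hij : i ≠ j) (hil : i ≠ l) (hjl : j ≠ l) :
    (Finset.univ : Finset (Fin 3)) = {i, j, l} := by
  revert i j l; decide

theorem prod_fin_three_of_ne {i j l : Fin 3} (hij : i ≠ j) (hil : i ≠ l) (hjl : j ≠ l)
    (f : Fin 3 → ℝ) : ∏ x, f x = f i * f j * f l := by
  rw [univ_fin_three_of_ne hij hil hjl, Finset.prod_insert (by simp [hij, hil]),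
    Finset.prod_insert (by simp [hjl]),
    Finset.prod_singleton, mul_assoc]

theorem sum_fin_three_of_ne {i j l : Fin 3} (hij : i ≠ j) (hil : i ≠ l) (hjl : j ≠ l)
    (f : Fin 3 → ℝ) : f 0 + f 1 + f 2 = f i + f j + f l := by
  rw [← Fin.sum_univ_three, univ_fin_three_of_ne hij hil hjl, Finset.sum_insert (by simp [hij, hil]),
    Finset.sum_insert (by simp [hjl]), Finset.sum_singleton, add_assoc]

/-- A Chernoff bound for the exponential moment of the difference of the numbers of two colours,
over the colourings in which the third colour occurs `a` times. -/
theorem sum_exp_le {n a : ℕ} {i j l : Fin 3} (hij : i ≠ j) (hil : i ≠ l) (hjl : j ≠ l)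
    {y : ℝ} (hy : 0 < y) (s : ℝ) :
    ∑ c : Fin n → Fin 3 with colorCount c Finset.univ i = a,
        Real.exp (s * ((colorCount c Finset.univ j : ℝ) - colorCount c Finset.univ l))
      ≤ (y ^ a)⁻¹ * (2 ^ n * Real.exp (n * (s ^ 2 / 2 + y / 2))) := by
  set g : Fin 3 → ℝ := fun x => if x = i then y else if x = j then Real.exp s else Real.exp (-s)
    with hg
  have gi : g i = y := by simp [hg]
  have gj : g j = Real.exp s := by simp [hg, hij.symm]
  have gl : g l = Real.exp (-s) := by simp [hg, hil.symm, hjl.symm]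
  have hgpos : ∀ x, 0 < g x := fun x => by
    simp only [hg]; split_ifs <;> positivity
  have h1 : ∀ c : Fin n → Fin 3, colorCount c Finset.univ i = a →
      Real.exp (s * ((colorCount c Finset.univ j : ℝ) - colorCount c Finset.univ l))
        = (y ^ a)⁻¹ * ∏ v, g (c v) := by
    intro c hc
    rw [prod_color_eq, prod_fin_three_of_ne hij hil hjl, gi, gj, gl, hc, ← Real.exp_nat_mul,
      ← Real.exp_nat_mul, mul_assoc, ← Real.exp_add, ← mul_assoc, inv_mul_cancel₀ (by positivity),
      one_mul]
    congr 1
    ring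
  calc ∑ c : Fin n → Fin 3 with colorCount c Finset.univ i = a,
        Real.exp (s * ((colorCount c Finset.univ j : ℝ) - colorCount c Finset.univ l))
      = ∑ c : Fin n → Fin 3 with colorCount c Finset.univ i = a, (y ^ a)⁻¹ * ∏ v, g (c v) :=
        Finset.sum_congr rfl fun c hc => h1 c (Finset.mem_filter.1 hc).2
    _ ≤ ∑ c : Fin n → Fin 3, (y ^ a)⁻¹ * ∏ v, g (c v) :=
        Finset.sum_le_sum_of_subset_of_nonneg (Finset.filter_subset _ _) fun c _ _ =>
          mul_nonneg (by positivity) (Finset.prod_nonneg fun v _ => (hgpos _).le)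
    _ = (y ^ a)⁻¹ * (y + Real.exp s + Real.exp (-s)) ^ n := by
        rw [← Finset.mul_sum, sum_prod_color, sum_fin_three_of_ne hij hil hjl, gi, gj, gl]
    _ ≤ (y ^ a)⁻¹ * (2 * Real.exp (s ^ 2 / 2 + y / 2)) ^ n := by
        gcongr
        have hc := Real.cosh_le_exp_half_sq s
        rw [Real.cosh_eq] at hc
        have e1 : 1 ≤ Real.exp (s ^ 2 / 2) := Real.one_le_exp (by positivity)
        have e2 := Real.add_one_le_exp (y / 2)
        rw [Real.exp_add]
        nlinarith
    _ = _ := by rw [mul_pow, ← Real.exp_nat_mul]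

/-- Choosing the a rare vertices costs about (n/a)^a, while the base is typically at most of order
√(a/n). Its cube leaves √(a/n) for each rare vertex; a square would leave only a constant. -/
theorem sum_rare_eq_le {n a : ℕ} (hn : 0 < n) {i j l : Fin 3} (hij : i ≠ j) (hil : i ≠ l)
    (hjl : j ≠ l) (ha : 0 < a) :
    ∑ c : Fin n → Fin 3 with colorCount c Finset.univ i = a,
        (2 * |(colorCount c Finset.univ j : ℝ) - colorCount c Finset.univ l| / n
          + √(6 * a / n)) ^ (3 * a)
      ≤ 2 * 2 ^ n * (27 * Real.exp 6 * √(a / n)) ^ a := by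
  have hn' : (0 : ℝ) < n := by exact_mod_cast hn
  have ha' : (0 : ℝ) < a := by exact_mod_cast ha
  set q : ℝ := √(a * n) with hq
  have hq0 : 0 < q := Real.sqrt_pos.2 (by positivity)
  have hq2 : q ^ 2 = a * n := Real.sq_sqrt (by positivity)
  -- With q = √(an), the power is bounded through x^m ≤ m! e^(qx) / q^m. This tilt makes q * 2|D|/n
  -- equal to s|D|, and the Gaussian exponent n s²/2 equal to 2a.
  set s : ℝ := 2 * q / n with hs
  have hs2 : n * (s ^ 2 / 2) = 2 * a := by
    rw [hs, div_pow, mul_pow, hq2]; field_simp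
  have hqs : q * √(6 * a / n) ≤ 3 * a := by
    rw [hq, ← Real.sqrt_mul (by positivity), Real.sqrt_le_left (by positivity)]
    have : (a : ℝ) * n * (6 * a / n) = 6 * a ^ 2 := by field_simp
    rw [this]
    nlinarith
  set C : ℝ := ((3 * a : ℕ) : ℝ) ^ (3 * a) / q ^ (3 * a) * Real.exp (3 * a) with hC
  have hCpos : 0 ≤ C := by positivity
  have hpt : ∀ D : ℝ, (2 * |D| / n + √(6 * a / n)) ^ (3 * a)
      ≤ C * (Real.exp (s * D) + Real.exp (-s * D)) := by
    intro D
    set x : ℝ := 2 * |D| / n + √(6 * a / n) with hx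
    have hx0 : 0 ≤ x := by positivity
    have h1 := Real.pow_div_factorial_le_exp (q * x) (by positivity) (3 * a)
    have h2 : Real.exp (q * x) ≤ Real.exp (3 * a) * (Real.exp (s * D) + Real.exp (-s * D)) := by
      have h3 : q * x ≤ 3 * a + s * |D| := by
        have : q * x = s * |D| + q * √(6 * a / n) := by rw [hx, hs]; ring
        linarith
      refine (Real.exp_le_exp.2 h3).trans ?_
      rw [Real.exp_add]
      refine mul_le_mul_of_nonneg_left ?_ (Real.exp_pos _).le
      rcases abs_cases D with ⟨h, -⟩ | ⟨h, -⟩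
      · rw [h]; linarith [Real.exp_pos (-s * D)]
      · rw [h, mul_neg, ← neg_mul]; linarith [Real.exp_pos (s * D)]
    have h4 : (((3 * a).factorial : ℕ) : ℝ) ≤ ((3 * a : ℕ) : ℝ) ^ (3 * a) := by
      exact_mod_cast Nat.factorial_le_pow (3 * a)
    rw [div_le_iff₀ (by positivity), mul_pow] at h1
    rw [hC, div_mul_eq_mul_div, div_mul_eq_mul_div, le_div_iff₀ (by positivity), mul_comm (x ^ _)]
    calc q ^ (3 * a) * x ^ (3 * a) ≤ Real.exp (q * x) * ((3 * a).factorial : ℕ) := h1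
      _ ≤ (Real.exp (3 * a) * (Real.exp (s * D) + Real.exp (-s * D)))
            * ((3 * a : ℕ) : ℝ) ^ (3 * a) := by gcongr
      _ = _ := by ring
  have hy : (0 : ℝ) < a / n := by positivity
  have b1 := sum_exp_le (n := n) (a := a) hij hil hjl hy s
  have b2 := sum_exp_le (n := n) (a := a) hij hil hjl hy (-s)
  rw [neg_sq] at b2
  have hexp : Real.exp (n * (s ^ 2 / 2 + a / n / 2)) ≤ Real.exp (3 * a) := by
    rw [Real.exp_le_exp, mul_add, hs2]
    have : (n : ℝ) * (a / n / 2) = a / 2 := by field_simp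
    linarith
  calc _ ≤ ∑ c : Fin n → Fin 3 with colorCount c Finset.univ i = a,
        C * (Real.exp (s * ((colorCount c Finset.univ j : ℝ) - colorCount c Finset.univ l))
          + Real.exp (-s * ((colorCount c Finset.univ j : ℝ) - colorCount c Finset.univ l))) :=
        Finset.sum_le_sum fun c _ => hpt _
    _ ≤ C * (2 * (((a / n : ℝ) ^ a)⁻¹ * (2 ^ n * Real.exp (3 * a)))) := by
        rw [← Finset.mul_sum, Finset.sum_add_distrib]
        refine mul_le_mul_of_nonneg_left ?_ hCpos
        have : ((a / n : ℝ) ^ a)⁻¹ * (2 ^ n * Real.exp (n * (s ^ 2 / 2 + a / n / 2)))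
            ≤ ((a / n : ℝ) ^ a)⁻¹ * (2 ^ n * Real.exp (3 * a)) := by gcongr
        linarith
    _ = 2 * 2 ^ n * (27 * Real.exp 6 * √(a / n)) ^ a := by
        have e1 : Real.exp (3 * a) = Real.exp 3 ^ a := by rw [← Real.exp_nat_mul]; ring_nf
        have e2 : Real.exp 6 = Real.exp 3 * Real.exp 3 := by rw [← Real.exp_add]; norm_num
        have e3 : √(a / n : ℝ) = q / n := by
          rw [show (a / n : ℝ) = a * n / n ^ 2 by field_simp, Real.sqrt_div (by positivity),
            Real.sqrt_sq hn'.le]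
        rw [hC, e1, e2, e3]
        push_cast
        rw [pow_mul, pow_mul, ← inv_pow]
        have : (27 * (Real.exp 3 * Real.exp 3) * (q / n)) = ((3 * a) ^ 3 / q ^ 3 * Real.exp 3)
            * (((a / n : ℝ))⁻¹ * Real.exp 3) := by
          have : q ^ 3 = a * n * q := by rw [pow_succ, hq2]
          rw [this]
          field_simp
          rw [hq2]
          ring
        rw [this]
        simp only [mul_pow, div_pow]
        ring

/-- The contribution of the colourings in which the colour `i` is rare but occurs. -/
theorem sum_rare_le {n : ℕ} (hn : 0 < n) {ε : ℝ} (hε' : 27 * Real.exp 6 * √ε ≤ 1 / 4)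
    {i j l : Fin 3} (hij : i ≠ j) (hil : i ≠ l) (hjl : j ≠ l) :
    ∑ c : Fin n → Fin 3 with
        0 < colorCount c Finset.univ i ∧ (colorCount c Finset.univ i : ℝ) ≤ ε * n,
        (2 * |(colorCount c Finset.univ j : ℝ) - colorCount c Finset.univ l| / n
          + √(6 * colorCount c Finset.univ i / n)) ^ (3 * colorCount c Finset.univ i)
      ≤ 2 ^ n * (8 * (27 * Real.exp 6) / √n) := by
  have hn' : (0 : ℝ) < n := by exact_mod_cast hn
  set C : ℝ := 27 * Real.exp 6 with hC
  have hC0 : 0 < C := by positivity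
  set S := (Finset.range (n + 1)).filter fun a : ℕ => 0 < a ∧ (a : ℝ) ≤ ε * n with hS
  have hmaps : ∀ c ∈ Finset.univ.filter fun c : Fin n → Fin 3 =>
      0 < colorCount c Finset.univ i ∧ (colorCount c Finset.univ i : ℝ) ≤ ε * n,
      colorCount c Finset.univ i ∈ S := by
    intro c hc
    rw [hS, Finset.mem_filter, Finset.mem_range]
    refine ⟨?_, (Finset.mem_filter.1 hc).2⟩
    have : colorCount c Finset.univ i ≤ (Finset.univ : Finset (Fin n)).card :=
      Finset.card_filter_le _ _
    rw [Finset.card_univ, Fintype.card_fin] at this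
    omega
  rw [← Finset.sum_fiberwise_of_maps_to hmaps]
  calc _ ≤ ∑ a ∈ S, 2 * 2 ^ n * (C * √(a / n)) ^ a := by
        refine Finset.sum_le_sum fun a ha => ?_
        refine le_trans ?_ (sum_rare_eq_le hn hij hil hjl (Finset.mem_filter.1 ha).2.1)
        rw [Finset.filter_filter]
        refine le_trans (le_of_eq (Finset.sum_congr rfl
          (g := fun c => (2 * |(colorCount c Finset.univ j : ℝ) - colorCount c Finset.univ l| / n
          + √(6 * a / n)) ^ (3 * a)) fun c hc => ?_)) ?_
        · rw [(Finset.mem_filter.1 hc).2.2]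
        · refine Finset.sum_le_sum_of_subset_of_nonneg (fun c hc => ?_) fun c _ _ => by positivity
          simp only [Finset.mem_filter] at hc ⊢
          exact ⟨hc.1, hc.2.2⟩
    -- One factor keeps its 1/√n; the other a - 1 are at most 1/4. Since √a ≤ 2^(a-1), a geometric
    -- series remains.
    _ ≤ ∑ a ∈ S, 2 * 2 ^ n * (C / √n * (4 * (1 / 2) ^ a)) := by
        refine Finset.sum_le_sum fun a ha => mul_le_mul_of_nonneg_left ?_ (by positivity)
        obtain ⟨-, ha0, hae⟩ := Finset.mem_filter.1 ha
        obtain ⟨b, rfl⟩ : ∃ b, a = b + 1 := ⟨a - 1, by omega⟩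
        have h1 : C * √((b + 1 : ℕ) / n) ≤ 1 / 4 := by
          refine le_trans ?_ hε'
          gcongr
          rwa [div_le_iff₀ hn']
        have h2 : √((b + 1 : ℕ) : ℝ) ≤ 2 ^ b := by
          rw [Real.sqrt_le_left (by positivity)]
          have : (b + 1 : ℕ) ≤ 2 ^ b := Nat.lt_two_pow_self
          have h3 : ((b + 1 : ℕ) : ℝ) ≤ 2 ^ b := by exact_mod_cast this
          have h4 : (1 : ℝ) ≤ 2 ^ b := one_le_pow₀ (by norm_num)
          nlinarith
        calc (C * √((b + 1 : ℕ) / n)) ^ (b + 1)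
            = (C * √((b + 1 : ℕ) / n)) ^ b * (C * √((b + 1 : ℕ) / n)) := pow_succ _ _
          _ ≤ (1 / 4) ^ b * (C * (2 ^ b / √n)) := by
              rw [Real.sqrt_div (by positivity)] at h1 ⊢
              gcongr
          _ = C / √n * (2 * (1 / 2) ^ (b + 1)) := by
              rw [pow_succ, show (1 / 4 : ℝ) = 1 / 2 * (1 / 2) by norm_num, mul_pow]
              have : (1 / 2 : ℝ) ^ b * 2 ^ b = 1 := by rw [← mul_pow]; norm_num
              linear_combination (C / √n * (1 / 2) ^ b) * this
          _ ≤ C / √n * (4 * (1 / 2) ^ (b + 1)) := by gcongr; norm_num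
    _ = 2 * 2 ^ n * (C / √n * (4 * ∑ a ∈ S, (1 / 2) ^ a)) := by
        simp only [Finset.mul_sum]
    _ ≤ 2 * 2 ^ n * (C / √n * (4 * 1)) := by
        gcongr
        have hsub : S ⊆ (Finset.range (n + 1)).erase 0 := by
          intro a ha
          simp only [hS, Finset.mem_filter] at ha
          simp only [Finset.mem_erase]
          exact ⟨ha.2.1.ne', ha.1⟩
        refine (Finset.sum_le_sum_of_subset_of_nonneg hsub fun _ _ _ => by positivity).trans ?_
        have h1 : ∑ a ∈ Finset.range (n + 1), (1 / 2 : ℝ) ^ a ≤ 2 := by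
          refine (Summable.sum_le_tsum _ (fun _ _ => by positivity) summable_geometric_two).trans ?_
          rw [tsum_geometric_two]
        have h2 := Finset.add_sum_erase (Finset.range (n + 1)) (fun a => (1 / 2 : ℝ) ^ a)
          (Finset.mem_range.2 (Nat.succ_pos n))
        simp only [pow_zero] at h2
        linarith
    _ = _ := by ring

/-! ### Combining rare and frequent colours -/

theorem abs_colorMean_le_of_rare {i j l : Fin 3} (hij : i ≠ j) (hil : i ≠ l) (hjl : j ≠ l)
    (k : Fin 3 → ℕ) (h : 8 * k i ≤ ∑ x, k x) :
    |colorMean k| ≤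
      (2 * |(k j : ℝ) - k l| / (∑ x, k x : ℕ) + √(6 * k i / (∑ x, k x : ℕ))) ^ k i := by
  have hs : ∑ x, k x = k j + k l + k i := by
    rw [univ_fin_three_of_ne hij hil hjl, Finset.sum_insert (by simp [hij, hil]),
    Finset.sum_insert (by simp [hjl]),
      Finset.sum_singleton]
    ring
  have hc : colorMean k = triMean (k j) (k l) (k i) := by
    obtain ⟨σ, h0, h1, h2⟩ : ∃ σ : Equiv.Perm (Fin 3), σ 0 = j ∧ σ 1 = l ∧ σ 2 = i := by
      clear h hs
      revert i j l; decide
    rw [← colorMean_comp_perm k σ, colorMean_eq_triMean]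
    simp only [Function.comp, h0, h1, h2]
  rw [hs] at h ⊢
  rw [hc]
  exact abs_triMean_le_of_rare _ _ _ h

theorem abs_colorMean_le_exp {ε : ℝ} (hε : 0 < ε) (k : Fin 3 → ℕ)
    (hk : ∀ i, ε * (∑ x, k x : ℕ) ≤ k i) (h4 : 4 ≤ ε * (∑ x, k x : ℕ)) :
    |colorMean k| ≤ Real.exp (-2 * (ε / 8) ^ 3) ^ (∑ x, k x) := by
  set N := ∑ x, k x with hN
  have hNpos : (0 : ℝ) < N := by
    by_contra hcon
    have : (N : ℝ) = 0 := le_antisymm (not_lt.1 hcon) (Nat.cast_nonneg _)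
    rw [this] at h4
    linarith
  -- The same j serves as reserve and as number of double exposures, since j + 3j ≤ εN. Rounding
  -- down loses at most half because εN/4 ≥ 1.
  set j : ℕ := ⌊ε * N / 4⌋₊ with hj
  have hj1 : (j : ℝ) ≤ ε * N / 4 := Nat.floor_le (by positivity)
  have hj2 : ε * N / 8 ≤ j := by
    have h1 : (1 : ℝ) ≤ j := by
      exact_mod_cast Nat.le_floor (by push_cast; linarith : ((1 : ℕ) : ℝ) ≤ ε * N / 4)
    have := Nat.lt_floor_add_one (ε * N / 4)
    rw [← hj] at this
    linarith
  have hjk : ∀ i, j + 3 * j ≤ k i := fun i => by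
    have := hk i
    have h5 : (j : ℝ) + 3 * j ≤ k i := by linarith
    exact_mod_cast h5
  have hsum : k 0 + k 1 + k 2 = N := by rw [hN, Fin.sum_univ_three]
  have hb := abs_triMean_le_pow j N j (k 0) (k 1) (k 2) (hjk 0) (hjk 1) (hjk 2) hsum.le
  rw [colorMean_eq_triMean]
  refine hb.trans ?_
  have hjN : (j : ℝ) ≤ N / 2 := by
    have h0 := hjk 0
    have h1 : 2 * j ≤ N := by omega
    have h2 : (2 * j : ℝ) ≤ N := by exact_mod_cast h1
    linarith
  have h0 : (0 : ℝ) ≤ 1 - 2 * j ^ 2 / N ^ 2 := by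
    rw [sub_nonneg, div_le_one (by positivity)]
    nlinarith [Nat.cast_nonneg (α := ℝ) j]
  calc (1 - 2 * j ^ 2 / N ^ 2 : ℝ) ^ j ≤ Real.exp (-(2 * j ^ 2 / N ^ 2)) ^ j := by
        gcongr
        exact Real.one_sub_le_exp_neg _
    _ ≤ Real.exp (-2 * (ε / 8) ^ 3) ^ N := by
        rw [← Real.exp_nat_mul, ← Real.exp_nat_mul, Real.exp_le_exp]
        have h6 : (ε * N / 8) ^ 3 ≤ (j : ℝ) ^ 3 := by gcongr
        have h7 : (N : ℝ) * (ε / 8) ^ 3 = (ε * N / 8) ^ 3 / N ^ 2 := by field_simp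
        have h8 : (j : ℝ) * (-(2 * j ^ 2 / N ^ 2)) = -2 * (j ^ 3 / N ^ 2) := by ring
        rw [h8, show (N : ℝ) * (-2 * (ε / 8) ^ 3) = -2 * (N * (ε / 8) ^ 3) by ring, h7]
        have : (ε * N / 8) ^ 3 / (N : ℝ) ^ 2 ≤ (j : ℝ) ^ 3 / N ^ 2 := by gcongr
        linarith

/-- The threshold below which a colour counts as rare. -/
def rareThreshold : ℝ := (1 / (108 * Real.exp 6)) ^ 2

theorem rareThreshold_pos : 0 < rareThreshold := by unfold rareThreshold; positivity

theorem rareThreshold_le : rareThreshold ≤ 1 / 8 := by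
  unfold rareThreshold
  have h1 : 1 ≤ Real.exp 6 := Real.one_le_exp (by norm_num)
  have h2 : 1 / (108 * Real.exp 6) ≤ 1 / 108 := by
    apply one_div_le_one_div_of_le <;> linarith
  have h3 : 0 ≤ 1 / (108 * Real.exp 6) := by positivity
  nlinarith

theorem sqrt_rareThreshold : 27 * Real.exp 6 * √rareThreshold ≤ 1 / 4 := by
  unfold rareThreshold
  rw [Real.sqrt_sq (by positivity)]
  have := Real.exp_pos 6
  field_simp
  norm_num

-- The reduction common to both models: if every colour occurs, either all are frequent or one of
-- the three is rare but present. Overlaps only enlarge the bound, and 648 = 3 * 8 * 27.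
open Classical in
theorem sum_present_le {n : ℕ} (hn : 0 < n) (φ : (Fin n → Fin 3) → ℝ) {B : ℝ}
    (hrare : ∀ c i j l, i ≠ j → i ≠ l → j ≠ l →
      (colorCount c Finset.univ i : ℝ) ≤ rareThreshold * n →
      |φ c| ≤ (2 * |(colorCount c Finset.univ j : ℝ) - colorCount c Finset.univ l| / n
          + √(6 * colorCount c Finset.univ i / n)) ^ (3 * colorCount c Finset.univ i))
    (hlarge : ∑ c with (∀ i, rareThreshold * n < colorCount c Finset.univ i), |φ c| ≤ 2 ^ n * B) :
    ∑ c with (∀ i, ∃ v, c v = i), |φ c| ≤ 2 ^ n * (648 * Real.exp 6 / √n + B) := by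
  have hr : ∀ i j l : Fin 3, i ≠ j → i ≠ l → j ≠ l → ∑ c : Fin n → Fin 3 with
      0 < colorCount c Finset.univ i ∧ (colorCount c Finset.univ i : ℝ) ≤ rareThreshold * n, |φ c|
      ≤ 2 ^ n * (8 * (27 * Real.exp 6) / √n) := fun i j l hij hil hjl => by
    refine le_trans (Finset.sum_le_sum fun c hc =>
      hrare c i j l hij hil hjl (Finset.mem_filter.1 hc).2.2) ?_
    convert! sum_rare_le hn sqrt_rareThreshold hij hil hjl
  have h0 := hr 0 1 2 (by decide) (by decide) (by decide)
  have h1 := hr 1 0 2 (by decide) (by decide) (by decide)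
  have h2 := hr 2 0 1 (by decide) (by decide) (by decide)
  rw [Finset.sum_filter] at hlarge h0 h1 h2
  have hpt : ∀ c ∈ Finset.univ.filter (fun c : Fin n → Fin 3 => ∀ i, ∃ v, c v = i), |φ c| ≤
      (if ∀ i, rareThreshold * n < colorCount c Finset.univ i then |φ c| else 0)
      + (if 0 < colorCount c Finset.univ 0 ∧
          (colorCount c Finset.univ 0 : ℝ) ≤ rareThreshold * n then |φ c| else 0)
      + (if 0 < colorCount c Finset.univ 1 ∧
          (colorCount c Finset.univ 1 : ℝ) ≤ rareThreshold * n then |φ c| else 0)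
      + (if 0 < colorCount c Finset.univ 2 ∧
          (colorCount c Finset.univ 2 : ℝ) ≤ rareThreshold * n then |φ c| else 0) := by
    intro c hc
    have hc := (Finset.mem_filter.1 hc).2
    have hpos : ∀ i, 0 < colorCount c Finset.univ i := fun i => by
      obtain ⟨v, hv⟩ := hc i
      exact Finset.card_pos.2 ⟨v, by simp [hv]⟩
    have ha := abs_nonneg (φ c)
    by_cases hl : ∀ i, rareThreshold * n < colorCount c Finset.univ i
    · rw [if_pos hl]
      split_ifs <;> linarith
    · rw [if_neg hl]
      push Not at hl
      obtain ⟨i, hi⟩ := hl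
      simp only [hpos, true_and]
      fin_cases i
      · simp only [Fin.zero_eta] at hi
        rw [if_pos hi]
        split_ifs <;> linarith
      · simp only [Fin.mk_one] at hi
        rw [if_pos hi]
        split_ifs <;> linarith
      · simp only [Fin.reduceFinMk] at hi
        rw [if_pos hi]
        split_ifs <;> linarith
  refine (Finset.sum_le_sum hpt).trans ?_
  refine (Finset.sum_le_sum_of_subset_of_nonneg (Finset.filter_subset _ _)
    fun c _ _ => ?_).trans ?_
  · have ha := abs_nonneg (φ c)
    split_ifs <;> linarith
  · simp only [Finset.sum_add_distrib]
    have : (2 : ℝ) ^ n * (648 * Real.exp 6 / √n + B)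
        = 2 ^ n * B + 3 * (2 ^ n * (8 * (27 * Real.exp 6) / √n)) := by ring
    rw [this]
    linarith

/-- The rate of exponential decay for colourings in which no colour is rare. -/
def decayRate : ℝ := Real.exp (-2 * (rareThreshold / 8) ^ 3)

theorem decayRate_pos : 0 < decayRate := Real.exp_pos _

theorem decayRate_lt_one : decayRate < 1 := by
  unfold decayRate
  rw [Real.exp_lt_one_iff]
  have := rareThreshold_pos
  have : 0 < (rareThreshold / 8) ^ 3 := by positivity
  linarith

theorem sum_colorCount_fin {n : ℕ} (c : Fin n → Fin 3) :
    ∑ i, colorCount c Finset.univ i = n := by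
  rw [sum_colorCount, Finset.card_univ, Fintype.card_fin]

theorem eight_mul_le_of_rare {n k : ℕ} (h : (k : ℝ) ≤ rareThreshold * n) : 8 * k ≤ n := by
  have h1 := mul_le_mul_of_nonneg_right rareThreshold_le (Nat.cast_nonneg (α := ℝ) n)
  have h2 : (8 * k : ℝ) ≤ n := by linarith
  exact_mod_cast h2

/-! ### Error bound for the matching model -/

theorem matchingSecondMoment_sub_le {n d : ℕ} (hn : 0 < n) (heven : Even n) (hd : 2 < d)
    (h4 : 4 ≤ rareThreshold * n) :
    |matchingSecondMoment n d - (if Odd d then 2 else 3)|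
      ≤ 3 * (2 ^ n)⁻¹ + (648 * Real.exp 6 / √n + (n + 1) * decayRate ^ n) := by
  classical
  have hcard : Even (Fintype.card (Fin n)) := by rwa [Fintype.card_fin]
  rw [matchingSecondMoment_eq]
  have habs : ∀ c : Fin n → Fin 3, |cutMean c ^ d| ≤ |colorMean (colorCount c Finset.univ)| ^ 3 :=
    fun c => by
      rw [abs_pow, abs_cutMean]
      exact pow_le_pow_of_le_one (abs_nonneg _) (abs_colorMean_le_one _) hd
  refine (abs_sum_sub_le hn.ne' (d := d) (fun c => cutMean c ^ d) ?_ ?_).trans ?_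
  · intro c hc
    rw [cutMean_eq_one hcard c hc, one_pow]
  · intro c hc
    rw [cutMean_eq_prod hcard c hc, ← Finset.prod_pow]
    refine Finset.prod_congr rfl fun v _ => ?_
    split_ifs <;> simp
  · refine add_le_add le_rfl ?_
    rw [inv_mul_le_iff₀ (by positivity)]
    refine sum_present_le hn _ ?_ ?_
    · intro c i j l hij hil hjl hi
      refine (habs c).trans ?_
      have := abs_colorMean_le_of_rare hij hil hjl (colorCount c Finset.univ)
        (by rw [sum_colorCount_fin]; exact eight_mul_le_of_rare hi)
      rw [sum_colorCount_fin] at this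
      rw [mul_comm 3, pow_mul]
      gcongr
    -- Of the three powers of the mean, one supplies exponential decay and two go into the L² bound.
    · calc _ ≤ ∑ c with (∀ i, rareThreshold * n < colorCount c Finset.univ i),
            decayRate ^ n * colorMean (colorCount c Finset.univ) ^ 2 := by
            refine Finset.sum_le_sum fun c hc => (habs c).trans ?_
            have hc := (Finset.mem_filter.1 hc).2
            have := abs_colorMean_le_exp rareThreshold_pos (colorCount c Finset.univ)
              (by rw [sum_colorCount_fin]; exact fun i => (hc i).le)
              (by rw [sum_colorCount_fin]; exact h4)
            rw [sum_colorCount_fin] at this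
            rw [pow_succ', sq_abs]
            exact mul_le_mul_of_nonneg_right this (sq_nonneg _)
        _ ≤ ∑ c : Fin n → Fin 3, decayRate ^ n * colorMean (colorCount c Finset.univ) ^ 2 :=
            Finset.sum_le_sum_of_subset_of_nonneg (Finset.filter_subset _ _) fun c _ _ =>
              mul_nonneg (pow_nonneg decayRate_pos.le _) (sq_nonneg _)
        _ ≤ decayRate ^ n * ((n + 1) * 2 ^ n) := by
            rw [← Finset.mul_sum]
            exact mul_le_mul_of_nonneg_left (sum_colorMean_sq_fin n)
              (pow_nonneg decayRate_pos.le _)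
        _ = _ := by ring

/-! ### Error bound for the pairing model -/

theorem colorCount_fst {n d : ℕ} (c : Fin n → Fin 3) :
    colorCount (fun v : Fin n × Fin d => c v.1) Finset.univ
      = fun i => d * colorCount c Finset.univ i := by
  funext i
  simp only [colorCount, Finset.card_filter, Fintype.sum_prod_type, Finset.mul_sum]
  refine Finset.sum_congr rfl fun v _ => ?_
  split_ifs <;> simp

/-- A d-tuple of colourings with counts `k` glues to one colouring of the points with counts `d *
k`. This lets the L² bound on the points control the number of vertex colourings. -/
theorem pow_card_colorCount_le (n d : ℕ) (k : Fin 3 → ℕ) :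
    (Finset.univ.filter fun c : Fin n → Fin 3 => colorCount c Finset.univ = k).card ^ d
      ≤ (Finset.univ.filter fun c : Fin n × Fin d → Fin 3 =>
          colorCount c Finset.univ = fun i => d * k i).card := by
  rw [← Fintype.card_piFinset_const]
  refine Finset.card_le_card_of_injOn (fun F v => F v.2 v.1) ?_ ?_
  · intro F hF
    have hF := Fintype.mem_piFinset.1 (Finset.mem_coe.1 hF)
    simp only [Finset.mem_filter, Finset.mem_univ, true_and] at hF
    refine Finset.mem_coe.2 (Finset.mem_filter.2 ⟨Finset.mem_univ _, ?_⟩)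
    funext i
    have : ∀ t, (∑ v, if F t v = i then 1 else 0) = k i := fun t => by
      rw [← hF t, colorCount, Finset.card_filter]
    simp only [colorCount, Finset.card_filter, Fintype.sum_prod_type_right, this, Finset.sum_const,
      Finset.card_univ, Fintype.card_fin, smul_eq_mul]
  · intro F _ F' _ h
    funext t v
    exact congrFun h (v, t)

/-- Few colourings have colour counts for which the mean sign of the pairing model is large. -/
theorem card_mul_abs_colorMean_le {n d : ℕ} (hd : 2 < d) (k : Fin 3 → ℕ) {η : ℝ} (hη : 0 ≤ η)
    (hk : |colorMean fun i => d * k i| ≤ η ^ (n * d)) :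
    ((Finset.univ.filter fun c : Fin n → Fin 3 => colorCount c Finset.univ = k).card : ℝ)
      * |colorMean fun i => d * k i| ≤ 2 ^ n * ((n * d + 1) * η ^ n) := by
  set m : ℝ := ((Finset.univ.filter fun c : Fin n → Fin 3 =>
    colorCount c Finset.univ = k).card : ℝ) with hm
  set f : ℝ := |colorMean fun i => d * k i| with hf
  have hf0 : 0 ≤ f := abs_nonneg _
  have hf1 : f ≤ 1 := abs_colorMean_le_one _
  have hL2 : m ^ d * f ^ 2 ≤ (n * d + 1) * 2 ^ (n * d) := by
    have h := sum_colorMean_sq (Fin n × Fin d)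
    rw [Fintype.card_prod, Fintype.card_fin, Fintype.card_fin] at h
    push_cast at h
    refine le_trans ?_ h
    calc m ^ d * f ^ 2 ≤ ((Finset.univ.filter fun c : Fin n × Fin d → Fin 3 =>
          colorCount c Finset.univ = fun i => d * k i).card : ℝ) * f ^ 2 := by
          gcongr
          rw [hm]
          exact_mod_cast pow_card_colorCount_le n d k
      _ = ∑ c : Fin n × Fin d → Fin 3 with colorCount c Finset.univ = fun i => d * k i,
            colorMean (colorCount c Finset.univ) ^ 2 := by
          rw [← nsmul_eq_mul, ← Finset.sum_const]
          refine Finset.sum_congr rfl fun c hc => ?_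
          rw [(Finset.mem_filter.1 hc).2, hf, sq_abs]
      _ ≤ _ := Finset.sum_le_sum_of_subset_of_nonneg (Finset.filter_subset _ _)
          fun c _ _ => sq_nonneg _
  have hm0 : 0 ≤ m := Nat.cast_nonneg _
  refine le_of_pow_le_pow_left₀ (n := d) (by omega) (by positivity) ?_
  -- The L² bound pays for m^d f². The rest satisfies f^(d-2) ≤ f ≤ η^(nd), as f ≤ 1 and d > 2; then
  -- a d-th root is taken.
  calc (m * f) ^ d = m ^ d * f ^ 2 * f ^ (d - 2) := by
        rw [mul_pow, mul_assoc, ← pow_add]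
        congr 2
        omega
    _ ≤ (n * d + 1) * 2 ^ (n * d) * η ^ (n * d) := by
        gcongr
        refine le_trans ?_ hk
        exact pow_le_of_le_one hf0 hf1 (by omega)
    _ ≤ (n * d + 1) ^ d * 2 ^ (n * d) * η ^ (n * d) := by
        gcongr
        refine le_self_pow₀ ?_ (by omega)
        have : (0 : ℝ) ≤ n * d := by positivity
        linarith
    _ = _ := by rw [mul_pow, mul_pow, ← pow_mul, ← pow_mul]; ring

/-- At most (n + 1)^3 count vectors occur, so a uniform bound per vector loses only a polynomial
factor. -/
theorem sum_le_of_fiber_le {n : ℕ} (P : (Fin n → Fin 3) → Prop) [DecidablePred P]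
    (f : (Fin 3 → ℕ) → ℝ) (hf : ∀ k, 0 ≤ f k) {B : ℝ} (hB : 0 ≤ B)
    (h : ∀ c, P c → ((Finset.univ.filter fun c' : Fin n → Fin 3 =>
      colorCount c' Finset.univ = colorCount c Finset.univ).card : ℝ)
        * f (colorCount c Finset.univ) ≤ B) :
    ∑ c with P c, f (colorCount c Finset.univ) ≤ (n + 1) ^ 3 * B := by
  set T := Fintype.piFinset fun _ : Fin 3 => Finset.range (n + 1) with hT
  have hmaps : ∀ c ∈ Finset.univ.filter P, colorCount c Finset.univ ∈ T := by
    intro c _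
    rw [hT, Fintype.mem_piFinset]
    intro i
    have : colorCount c Finset.univ i ≤ (Finset.univ : Finset (Fin n)).card :=
      Finset.card_filter_le _ _
    rw [Finset.card_univ, Fintype.card_fin] at this
    exact Finset.mem_range.2 (by omega)
  rw [← Finset.sum_fiberwise_of_maps_to hmaps]
  have hcard : ((T.card : ℕ) : ℝ) = (n + 1) ^ 3 := by
    rw [hT, Fintype.card_piFinset_const, Finset.card_range]
    push_cast
    rfl
  rw [← hcard, ← nsmul_eq_mul]
  refine Finset.sum_le_card_nsmul _ _ _ fun k _ => ?_
  rcases (Finset.filter (fun c => colorCount c Finset.univ = k) (Finset.univ.filter P)).eq_empty_or_nonempty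
    with he | ⟨c, hc⟩
  · rw [he, Finset.sum_empty]; exact hB
  · simp only [Finset.mem_filter, Finset.mem_univ, true_and] at hc
    obtain ⟨hP, rfl⟩ := hc
    refine le_trans ?_ (h c hP)
    rw [Finset.sum_congr rfl (g := fun _ => f (colorCount c Finset.univ))
      (fun c' hc' => by rw [(Finset.mem_filter.1 hc').2]), Finset.sum_const, nsmul_eq_mul]
    refine mul_le_mul_of_nonneg_right ?_ (hf _)
    exact_mod_cast Finset.card_le_card (Finset.filter_subset_filter _ (Finset.filter_subset _ _))

theorem pairingSecondMoment_sub_le {n d : ℕ} (hn : 0 < n) (heven : Even (n * d)) (hd : 2 < d)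
    (h4 : 4 ≤ rareThreshold * n) :
    |pairingSecondMoment n d - (if Odd d then 2 else 3)|
      ≤ 3 * (2 ^ n)⁻¹ + (648 * Real.exp 6 / √n +
        (n + 1) ^ 3 * ((n * d + 1) * decayRate ^ n)) := by
  classical
  have hcard : Even (Fintype.card (Fin n × Fin d)) := by
    rwa [Fintype.card_prod, Fintype.card_fin, Fintype.card_fin]
  have hd' : (0 : ℝ) < d := by exact_mod_cast (by omega : 0 < d)
  have hn' : (0 : ℝ) < n := by exact_mod_cast hn
  have hsum : ∀ c : Fin n → Fin 3, ∑ i, d * colorCount c Finset.univ i = n * d := fun c => by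
    rw [← Finset.mul_sum, sum_colorCount_fin, mul_comm]
  rw [pairingSecondMoment_eq]
  have habs : ∀ c : Fin n → Fin 3, |cutMean (fun v : Fin n × Fin d => c v.1)|
      = |colorMean fun i => d * colorCount c Finset.univ i| :=
    fun c => by rw [abs_cutMean, colorCount_fst]
  refine (abs_sum_sub_le hn.ne' (d := d) (fun c => cutMean fun v : Fin n × Fin d => c v.1)
    ?_ ?_).trans ?_
  · intro c hc
    refine cutMean_eq_one hcard _ ?_
    rcases hc with hc | hc
    · exact Or.inl fun v => hc v.1
    · exact Or.inr fun v => hc v.1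
  · intro c hc
    rw [cutMean_eq_prod hcard _ fun v => hc v.1, Fintype.prod_prod_type]
    refine Finset.prod_congr rfl fun v _ => ?_
    split_ifs <;> simp
  · refine add_le_add le_rfl ?_
    rw [inv_mul_le_iff₀ (by positivity)]
    refine sum_present_le hn _ ?_ ?_
    · intro c i j l hij hil hjl hi
      rw [habs]
      have h := abs_colorMean_le_of_rare hij hil hjl (fun i => d * colorCount c Finset.univ i)
        (by
          rw [hsum]
          have := Nat.mul_le_mul_right d (eight_mul_le_of_rare hi)
          linarith)
      rw [hsum] at h
      push_cast at h
      have e1 : 2 * |(d : ℝ) * (colorCount c Finset.univ j : ℝ)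
            - d * (colorCount c Finset.univ l : ℝ)| / (n * d)
          = 2 * |(colorCount c Finset.univ j : ℝ) - colorCount c Finset.univ l| / n := by
        rw [← mul_sub, abs_mul, abs_of_pos hd']
        field_simp
      have e2 : 6 * ((d : ℝ) * (colorCount c Finset.univ i : ℝ)) / (n * d)
          = 6 * colorCount c Finset.univ i / n := by field_simp
      rw [e1, e2] at h
      set x : ℝ := 2 * |(colorCount c Finset.univ j : ℝ) - colorCount c Finset.univ l| / n
        + √(6 * colorCount c Finset.univ i / n) with hx
      have hx0 : 0 ≤ x := by positivity
      -- Lowering the exponent from da to 3a needs x ≤ 1; for x ≥ 1 the trivial bound 1 is enough.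
      rcases le_total x 1 with hx1 | hx1
      · exact h.trans (pow_le_pow_of_le_one hx0 hx1 (Nat.mul_le_mul_right _ hd))
      · exact (abs_colorMean_le_one _).trans (one_le_pow₀ hx1)
    · simp only [habs]
      rw [mul_left_comm]
      refine sum_le_of_fiber_le (fun c : Fin n → Fin 3 =>
        ∀ i, rareThreshold * n < colorCount c Finset.univ i) (fun k => |colorMean fun i => d * k i|)
        (fun k => abs_nonneg _) ?_ ?_
      · have := decayRate_pos
        positivity
      · intro c hc
        refine card_mul_abs_colorMean_le hd _ decayRate_pos.le ?_
        have h := abs_colorMean_le_exp rareThreshold_pos (fun i => d * colorCount c Finset.univ i)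
          (by
            rw [hsum]
            intro i
            push_cast
            have := mul_le_mul_of_nonneg_left (hc i).le hd'.le
            linarith)
          (by
            rw [hsum]
            push_cast
            have : (1 : ℝ) ≤ d := by exact_mod_cast (by omega : 1 ≤ d)
            nlinarith)
        rw [hsum] at h
        exact h

/-! ### The limit -/

theorem tendsto_error {c : ℝ} {r : ℝ} (hr0 : 0 < r) (hr1 : r < 1) :
    Tendsto (fun n : ℕ => 3 * ((2 : ℝ) ^ n)⁻¹ + (c / √n + (n + 1) ^ 3 * ((n * n + 1) * r ^ n)))
      atTop (𝓝 0) := by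
  have h1 : Tendsto (fun n : ℕ => 3 * ((2 : ℝ) ^ n)⁻¹) atTop (𝓝 0) := by
    have := (tendsto_pow_atTop_nhds_zero_of_lt_one (r := (1 / 2 : ℝ)) (by norm_num)
      (by norm_num)).const_mul 3
    simpa using this
  have h2 : Tendsto (fun n : ℕ => c / √n) atTop (𝓝 0) :=
    tendsto_const_nhds.div_atTop (Real.tendsto_sqrt_atTop.comp tendsto_natCast_atTop_atTop)
  have hk : ∀ k : ℕ, Tendsto (fun n : ℕ => (n : ℝ) ^ k * r ^ n) atTop (𝓝 0) := fun k =>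
    tendsto_pow_const_mul_const_pow_of_abs_lt_one k (by rwa [abs_of_pos hr0])
  have h3 : Tendsto (fun n : ℕ => ((n : ℝ) + 1) ^ 3 * ((n * n + 1) * r ^ n)) atTop (𝓝 0) := by
    have := (((((hk 5).add ((hk 4).const_mul 3)).add ((hk 3).const_mul 4)).add
      ((hk 2).const_mul 4)).add ((hk 1).const_mul 3)).add (hk 0)
    simp only [mul_zero, add_zero] at this
    refine this.congr fun n => ?_
    ring
  simpa using h1.add (h2.add h3)

end

theorem mainTheorem1 (d : ℕ → ℕ) (hd : ∀ᶠ n in atTop, 2 < d n)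
    (hdo : (fun n : ℕ => (d n : ℝ)) =o[atTop] fun n : ℕ => (n : ℝ) ^ (1 / 2 : ℝ)) :
    Tendsto (fun n : ℕ => pairingSecondMoment n (d n) - (if Odd (d n) then 2 else 3))
        (atTop ⊓ 𝓟 {n : ℕ | Even (n * d n)}) (𝓝 0) ∧
      Tendsto (fun n : ℕ => matchingSecondMoment n (d n) - (if Odd (d n) then 2 else 3))
        (atTop ⊓ 𝓟 {n : ℕ | Even n}) (𝓝 0) := by
  -- This keeps the factor nd + 1 in the pairing error below n² + 1, which the exponential decay
  -- absorbs.
  have hdn : ∀ᶠ n in atTop, (d n : ℝ) ≤ n := by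
    filter_upwards [hdo.bound one_pos, eventually_ge_atTop 1] with n hn h1
    have h1' : (1 : ℝ) ≤ n := by exact_mod_cast h1
    rw [one_mul, Real.norm_natCast, Real.norm_of_nonneg (by positivity)] at hn
    exact hn.trans (Real.rpow_le_self_of_one_le h1' (by norm_num))
  have h4 : ∀ᶠ n : ℕ in atTop, 4 ≤ rareThreshold * n :=
    (tendsto_natCast_atTop_atTop.const_mul_atTop rareThreshold_pos).eventually_ge_atTop 4
  have herr := tendsto_error (c := 648 * Real.exp 6) decayRate_pos decayRate_lt_one
  constructor
  · refine squeeze_zero_norm' ?_ (herr.mono_left inf_le_left)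
    rw [eventually_inf_principal]
    filter_upwards [hd, hdn, h4, eventually_gt_atTop 0] with n h2 hn h4 h0 heven
    rw [Real.norm_eq_abs]
    refine (pairingSecondMoment_sub_le h0 heven h2 h4).trans ?_
    have := decayRate_pos
    gcongr
  · refine squeeze_zero_norm' ?_ (herr.mono_left inf_le_left)
    rw [eventually_inf_principal]
    filter_upwards [hd, h4, eventually_gt_atTop 0] with n h2 h4 h0 heven
    rw [Real.norm_eq_abs]
    refine (matchingSecondMoment_sub_le h0 heven h2 h4).trans ?_
    have hr : 0 < decayRate ^ n := pow_pos decayRate_pos n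
    have h1 : (n + 1 : ℝ) ≤ (n + 1) ^ 3 := le_self_pow₀ (by linarith [Nat.cast_nonneg (α := ℝ) n])
      (by norm_num)
    have h2 : decayRate ^ n ≤ (n * n + 1) * decayRate ^ n := by
      nlinarith [mul_nonneg (mul_self_nonneg (n : ℝ)) hr.le]
    gcongr
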